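/- A 2-tree is a graph obtained from a single edge by repeatedly adding a new vertex adjacent to exactly the two endpoints of an existing edge (the new vertex is then said to be added as a simplicial vertex to that edge). The edge-length ratio of a planar straight-line drawing of a graph is the length of its longest edge divided by the length of its shortest edge, and the edge-length ratio $\rho(G)$ of a planar graph $G$ is the infimum of the edge-length ratios of all planar straight-line drawings of $G$ in the Euclidean plane. Let $G_0$ be the triangle $K_3$ with all edges labeled $0$, and for $i\ge 0$ let $G_{i+1}$ be obtained from $G_i$ by adding five simplicial vertices to each edge of label $i$; all edges created in this step get label $i+1$. Theorem. For every real $r\ge 1$ there is a (finite) 2-tree $G$ with $\rho(G)\ge r$. Moreover, $G$ can be taken to be $G_{k+\lceil 4r\rceil}$ with $k=\lceil 2+2\log_2 r\rceil$. -/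

import Mathlib

/-- `2`-trees. A graph consisting of a single edge is a `2`-tree, and a graph `G` is a `2`-tree if
it has a vertex `w` whose neighbours are exactly the two endpoints of an edge `uv`, such that
removing `w` leaves a `2`-tree (that is, `G` arises from a `2`-tree by adding `w` as a simplicial
vertex to the edge `uv`). -/
inductive IsTwoTree : {V : Type} → SimpleGraph V → Prop
  | edge {V : Type} (G : SimpleGraph V) (u v : V) (huv : G.Adj u v)
      (hV : ∀ x : V, x = u ∨ x = v) : IsTwoTree G
  | addSimplicial {V : Type} (G : SimpleGraph V) (w u v : V) (huv : G.Adj u v)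
      (hw : ∀ x : V, G.Adj w x ↔ x = u ∨ x = v)
      (hG : IsTwoTree (G.induce {x : V | x ≠ w})) : IsTwoTree G

/-- `p` places the vertices of `G` in the Euclidean plane so that drawing every edge as the straight
segment between its endpoints gives a planar drawing: distinct vertices are distinct points, no
vertex lies on an edge of which it is not an endpoint, and distinct edges do not meet in their
relative interiors. -/
structure IsPlanarStraightLineDrawing {V : Type} (G : SimpleGraph V)
    (p : V → EuclideanSpace ℝ (Fin 2)) : Prop where
  injective : Function.Injective p
  vertex_notMem : ∀ u v w : V, G.Adj u v → w ≠ u → w ≠ v → p w ∉ segment ℝ (p u) (p v)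
  edges_disjoint : ∀ u v x y : V, G.Adj u v → G.Adj x y → s(u, v) ≠ s(x, y) →
    Disjoint (openSegment ℝ (p u) (p v)) (openSegment ℝ (p x) (p y))

/-- The set of lengths of the edges of `G` in the straight-line drawing `p`. -/
def edgeLengths {V : Type} (G : SimpleGraph V) (p : V → EuclideanSpace ℝ (Fin 2)) : Set ℝ :=
  {d | ∃ u v : V, G.Adj u v ∧ d = dist (p u) (p v)}

/-- The edge-length ratio of a straight-line drawing: the length of the longest edge divided by
the length of the shortest edge (for a finite graph with an edge, the supremum and the infimum
are attained). -/
noncomputable def drawingRatio {V : Type} (G : SimpleGraph V)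
    (p : V → EuclideanSpace ℝ (Fin 2)) : ℝ :=
  sSup (edgeLengths G p) / sInf (edgeLengths G p)

/-- The edge-length ratio `ρ(G)` of a planar graph: the infimum of the edge-length ratios of its
planar straight-line drawings. (For a graph without such a drawing the value is `0`, so a positive
lower bound on `edgeLengthRatio G` includes that `G` has a planar straight-line drawing.) -/
noncomputable def edgeLengthRatio {V : Type} (G : SimpleGraph V) : ℝ :=
  sInf {t : ℝ | ∃ p : V → EuclideanSpace ℝ (Fin 2),
    IsPlanarStraightLineDrawing G p ∧ t = drawingRatio G p}

/-- A graph together with the set of those of its edges that carry the current (largest) label. -/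
structure LabeledStage where
  /-- the vertices -/
  V : Type
  /-- the graph -/
  graph : SimpleGraph V
  /-- the edges with the current label -/
  newEdges : Set (Sym2 V)

/-- Add to every edge in `F` five new simplicial vertices `(e, 0), …, (e, 4)`. -/
def addFive {V : Type} (G : SimpleGraph V) (F : Set (Sym2 V)) :
    SimpleGraph (V ⊕ (F × Fin 5)) where
  Adj
    | .inl u, .inl v => G.Adj u v
    | .inl u, .inr a => u ∈ a.1.1
    | .inr a, .inl u => u ∈ a.1.1
    | .inr _, .inr _ => False
  symm := ⟨by
    rintro (u | a) (v | b) h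
    · exact SimpleGraph.Adj.symm h
    · exact h
    · exact h
    · exact h⟩
  loopless := ⟨by
    rintro (u | a) h
    · exact G.irrefl h
    · exact h⟩

/-- The recursive construction. Stage `0` is the triangle with all edges labeled `0`; stage `i + 1`
adds five simplicial vertices to each edge of label `i` of stage `i`, and the edges of label `i + 1`
are those incident with the vertices just added. -/
def labeledStage : ℕ → LabeledStage
  | 0 => ⟨Fin 3, ⊤, (⊤ : SimpleGraph (Fin 3)).edgeSet⟩
  | i + 1 =>
    ⟨(labeledStage i).V ⊕ ((labeledStage i).newEdges × Fin 5),
      addFive (labeledStage i).graph (labeledStage i).newEdges,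
      {e | ∃ (u : (labeledStage i).V) (a : (labeledStage i).newEdges × Fin 5),
        u ∈ a.1.1 ∧ e = s(.inl u, .inr a)}⟩

/-! Suppose a drawing has ratio below r, and scale it so that edge lengths lie in [1, r). Of five
vertices attached to an edge uv, three lie on one side of uv, and planarity nests their triangles: a
`Chain` with apexes x, y, z from outside in. The edges from u and v to y and z carry chains again,
whose outer triangles lie inside uvx. The proof bounds the length of such an inward walk.

Area (`exists_chain_half`): the outer triangles on uy and vy have disjoint interiors inside uvx, so
one has at most half the area. Doubled area starts at most r^2, and k steps bring it to 1/4.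

Length (`stages_le`): a triangle of doubled area at most 1/4 and longest side D ≥ 1 has height at
most 1/4 over that side, so distances exceed projections by at most 1/4, and every edge projects to
length at least 3/4. If D is attained at the base uv, then uy is a next base of length at most D -
1/2. If not, the next chain can be chosen to miss 3/4 of the projection at one end, so the longest
side drops by 1/2; the third apex z is needed for this choice. Thus 1/2 is lost at least every two
steps, while the longest side stays in [1, r).

Since an infimum over no drawings would be 0, every 2-tree is also shown to have a drawing. -/

/-- The Euclidean plane. -/
abbrev Plane := EuclideanSpace ℝ (Fin 2)

/-! ### Orientation, barycentric coordinates and triangles -/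

/-- Twice the signed area of the triangle `abc`. -/
def orient (a b c : Plane) : ℝ :=
  (b 0 - a 0) * (c 1 - a 1) - (b 1 - a 1) * (c 0 - a 0)

/-- The points with positive barycentric coordinates with respect to `a`, `b`, `c`. -/
def openTriangle (a b c : Plane) : Set Plane :=
  {x | ∃ α β γ : ℝ, 0 < α ∧ 0 < β ∧ 0 < γ ∧ α + β + γ = 1 ∧ x = α • a + β • b + γ • c}

/-- The points with nonnegative barycentric coordinates with respect to `a`, `b`, `c`. -/
def closedTriangle (a b c : Plane) : Set Plane :=
  {x | ∃ α β γ : ℝ, 0 ≤ α ∧ 0 ≤ β ∧ 0 ≤ γ ∧ α + β + γ = 1 ∧ x = α • a + β • b + γ • c}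

theorem plane_ext {x y : Plane} (h0 : x 0 = y 0) (h1 : x 1 = y 1) : x = y := by
  ext i; fin_cases i <;> assumption

theorem orient_combo_left (a b c : Plane) {α β γ : ℝ} (h : α + β + γ = 1) :
    orient (α • a + β • b + γ • c) b c = α * orient a b c := by
  obtain rfl : α = 1 - β - γ := by linarith
  simp only [orient, PiLp.add_apply, PiLp.smul_apply, smul_eq_mul]; ring

theorem orient_combo_mid (a b c : Plane) {α β γ : ℝ} (h : α + β + γ = 1) :
    orient a (α • a + β • b + γ • c) c = β * orient a b c := by
  obtain rfl : α = 1 - β - γ := by linarith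
  simp only [orient, PiLp.add_apply, PiLp.smul_apply, smul_eq_mul]; ring

theorem orient_combo_right (a b c : Plane) {α β γ : ℝ} (h : α + β + γ = 1) :
    orient a b (α • a + β • b + γ • c) = γ * orient a b c := by
  obtain rfl : α = 1 - β - γ := by linarith
  simp only [orient, PiLp.add_apply, PiLp.smul_apply, smul_eq_mul]; ring

theorem orient_rotate (a b c : Plane) : orient b c a = orient a b c := by
  simp only [orient]; ring

theorem orient_swap (a b c : Plane) : orient b a c = -orient a b c := by
  simp only [orient]; ring

theorem orient_swap_right (a b c : Plane) : orient a c b = -orient a b c := by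
  simp only [orient]; ring

theorem orient_sum (a b c x : Plane) :
    orient x b c + orient a x c + orient a b x = orient a b c := by
  simp only [orient]; ring

theorem exists_barycentric {a b c : Plane} (h : orient a b c ≠ 0) (x : Plane) :
    ∃ α β γ : ℝ, α + β + γ = 1 ∧ x = α • a + β • b + γ • c := by
  refine ⟨orient x b c / orient a b c, orient a x c / orient a b c, orient a b x / orient a b c,
    ?_, ?_⟩
  · rw [← add_div, ← add_div, orient_sum, div_self h]
  · apply plane_ext <;>
    · simp only [PiLp.add_apply, PiLp.smul_apply, smul_eq_mul]
      field_simp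
      simp only [orient]; ring

theorem openTriangle_subset_closedTriangle (a b c : Plane) :
    openTriangle a b c ⊆ closedTriangle a b c := by
  rintro x ⟨α, β, γ, h1, h2, h3, h⟩
  exact ⟨α, β, γ, h1.le, h2.le, h3.le, h⟩

theorem mem_openTriangle_iff {a b c : Plane} (h : orient a b c ≠ 0) (x : Plane) :
    x ∈ openTriangle a b c ↔ 0 < orient x b c / orient a b c ∧
      0 < orient a x c / orient a b c ∧ 0 < orient a b x / orient a b c := by
  constructor
  · rintro ⟨α, β, γ, h1, h2, h3, hs, rfl⟩
    rw [orient_combo_left _ _ _ hs, orient_combo_mid _ _ _ hs, orient_combo_right _ _ _ hs]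
    simp only [mul_div_assoc, div_self h, mul_one]
    exact ⟨h1, h2, h3⟩
  · obtain ⟨α, β, γ, hs, rfl⟩ := exists_barycentric h x
    rw [orient_combo_left _ _ _ hs, orient_combo_mid _ _ _ hs, orient_combo_right _ _ _ hs]
    simp only [mul_div_assoc, div_self h, mul_one]
    rintro ⟨h1, h2, h3⟩
    exact ⟨α, β, γ, h1, h2, h3, hs, rfl⟩

theorem mem_closedTriangle_iff {a b c : Plane} (h : orient a b c ≠ 0) (x : Plane) :
    x ∈ closedTriangle a b c ↔ 0 ≤ orient x b c / orient a b c ∧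
      0 ≤ orient a x c / orient a b c ∧ 0 ≤ orient a b x / orient a b c := by
  constructor
  · rintro ⟨α, β, γ, h1, h2, h3, hs, rfl⟩
    rw [orient_combo_left _ _ _ hs, orient_combo_mid _ _ _ hs, orient_combo_right _ _ _ hs]
    simp only [mul_div_assoc, div_self h, mul_one]
    exact ⟨h1, h2, h3⟩
  · obtain ⟨α, β, γ, hs, rfl⟩ := exists_barycentric h x
    rw [orient_combo_left _ _ _ hs, orient_combo_mid _ _ _ hs, orient_combo_right _ _ _ hs]
    simp only [mul_div_assoc, div_self h, mul_one]
    rintro ⟨h1, h2, h3⟩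
    exact ⟨α, β, γ, h1, h2, h3, hs, rfl⟩

theorem continuous_orient_left (b c : Plane) : Continuous fun x => orient x b c := by
  unfold orient; fun_prop

theorem continuous_orient_mid (a c : Plane) : Continuous fun x => orient a x c := by
  unfold orient; fun_prop

theorem continuous_orient_right (a b : Plane) : Continuous fun x => orient a b x := by
  unfold orient; fun_prop

theorem isOpen_openTriangle {a b c : Plane} (h : orient a b c ≠ 0) :
    IsOpen (openTriangle a b c) := by
  have : openTriangle a b c = {x | 0 < orient x b c / orient a b c} ∩
      ({x | 0 < orient a x c / orient a b c} ∩ {x | 0 < orient a b x / orient a b c}) := by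
    ext x; exact mem_openTriangle_iff h x
  rw [this]
  exact (isOpen_lt continuous_const ((continuous_orient_left b c).div_const _)).inter
    ((isOpen_lt continuous_const ((continuous_orient_mid a c).div_const _)).inter
      (isOpen_lt continuous_const ((continuous_orient_right a b).div_const _)))

/-- A point of the closed triangle outside the open one lies on a side. -/
theorem mem_side_of_mem_closedTriangle {a b c x : Plane} (hx : x ∈ closedTriangle a b c)
    (hx' : x ∉ openTriangle a b c) :
    x ∈ segment ℝ a b ∨ x ∈ segment ℝ b c ∨ x ∈ segment ℝ c a := by
  obtain ⟨α, β, γ, h1, h2, h3, hs, rfl⟩ := hx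
  rcases h1.eq_or_lt with rfl | h1
  · exact .inr (.inl ⟨β, γ, h2, h3, by linarith, by simp⟩)
  rcases h2.eq_or_lt with rfl | h2
  · exact .inr (.inr ⟨γ, α, h3, h1.le, by linarith, by simp [add_comm]⟩)
  rcases h3.eq_or_lt with rfl | h3
  · exact .inl ⟨α, β, h1.le, h2.le, by linarith, by simp⟩
  exact absurd ⟨α, β, γ, h1, h2, h3, hs, rfl⟩ hx'

theorem side_disjoint_openTriangle {a b c x : Plane} (h : orient a b c ≠ 0)
    (hx : x ∈ segment ℝ a b ∨ x ∈ segment ℝ b c ∨ x ∈ segment ℝ c a) :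
    x ∉ openTriangle a b c := by
  rw [mem_openTriangle_iff h]
  rintro ⟨h1, h2, h3⟩
  rcases hx with ⟨s, t, -, -, hst, rfl⟩ | ⟨s, t, -, -, hst, rfl⟩ | ⟨s, t, -, -, hst, rfl⟩
  · have := orient_combo_right a b c (α := s) (β := t) (γ := 0) (by linarith)
    simp only [zero_smul, add_zero, zero_mul] at this
    simp [this] at h3
  · have := orient_combo_left a b c (α := 0) (β := s) (γ := t) (by linarith)
    simp only [zero_smul, zero_add, zero_mul] at this
    simp [this] at h1
  · have := orient_combo_mid a b c (α := t) (β := 0) (γ := s) (by linarith)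
    simp only [zero_smul, add_zero, zero_mul] at this
    rw [add_comm] at this
    simp [this] at h2

/-- A segment that leaves an open triangle passes through one of its sides. -/
theorem exists_mem_side_of_exit {a b c q s : Plane} (h : orient a b c ≠ 0)
    (hq : q ∈ openTriangle a b c) (hs : s ∉ openTriangle a b c) :
    ∃ t : ℝ, 0 < t ∧ t ≤ 1 ∧ AffineMap.lineMap q s t ∈ closedTriangle a b c ∧
      (AffineMap.lineMap q s t ∈ segment ℝ a b ∨ AffineMap.lineMap q s t ∈ segment ℝ b c ∨
        AffineMap.lineMap q s t ∈ segment ℝ c a) := by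
  set o := orient a b c
  let F : Plane → ℝ := fun x => min (orient x b c / o) (min (orient a x c / o) (orient a b x / o))
  have hF : Continuous F := ((continuous_orient_left b c).div_const _).min
    (((continuous_orient_mid a c).div_const _).min ((continuous_orient_right a b).div_const _))
  have hopen : ∀ x, x ∈ openTriangle a b c ↔ 0 < F x := by
    intro x; rw [mem_openTriangle_iff h]; simp [F, o]
  have hclosed : ∀ x, x ∈ closedTriangle a b c ↔ 0 ≤ F x := by
    intro x; rw [mem_closedTriangle_iff h]; simp [F, o]
  have hcont : ContinuousOn (fun t : ℝ => F (AffineMap.lineMap q s t)) (Set.Icc 0 1) :=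
    (hF.comp AffineMap.lineMap_continuous).continuousOn
  have hmem : (0 : ℝ) ∈ Set.Icc (F (AffineMap.lineMap q s (1 : ℝ)))
      (F (AffineMap.lineMap q s (0 : ℝ))) := by
    rw [AffineMap.lineMap_apply_one, AffineMap.lineMap_apply_zero]
    exact ⟨not_lt.1 fun hc => hs ((hopen _).2 hc), ((hopen _).1 hq).le⟩
  obtain ⟨t, ⟨ht0, ht1⟩, ht⟩ := intermediate_value_Icc' zero_le_one hcont hmem
  simp only at ht
  have hcl : AffineMap.lineMap q s t ∈ closedTriangle a b c := (hclosed _).2 ht.ge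
  refine ⟨t, lt_of_le_of_ne ht0 ?_, ht1, hcl, mem_side_of_mem_closedTriangle hcl ?_⟩
  · rintro rfl
    rw [AffineMap.lineMap_apply_zero] at ht
    exact ((hopen _).1 hq).ne' ht
  · rw [hopen, ht]; exact lt_irrefl 0

/-- A triangle spanned by points of a closed triangle, one of which is interior, has its interior
inside the open triangle. -/
theorem openTriangle_subset_openTriangle {a b c x y z : Plane} (hx : x ∈ closedTriangle a b c)
    (hy : y ∈ openTriangle a b c) (hz : z ∈ closedTriangle a b c) :
    openTriangle x y z ⊆ openTriangle a b c := by
  obtain ⟨a1, b1, c1, ha1, hb1, hc1, hs1, rfl⟩ := hx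
  obtain ⟨a2, b2, c2, ha2, hb2, hc2, hs2, rfl⟩ := hy
  obtain ⟨a3, b3, c3, ha3, hb3, hc3, hs3, rfl⟩ := hz
  rintro _ ⟨α, β, γ, h1, h2, h3, hs, rfl⟩
  refine ⟨α * a1 + β * a2 + γ * a3, α * b1 + β * b2 + γ * b3, α * c1 + β * c2 + γ * c3,
    by positivity, by positivity, by positivity, ?_, by module⟩
  linear_combination α * hs1 + β * hs2 + γ * hs3 + hs

theorem left_mem_closedTriangle (a b c : Plane) : a ∈ closedTriangle a b c :=
  ⟨1, 0, 0, by simp, by simp, by simp, by simp, by simp⟩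

theorem mid_mem_closedTriangle (a b c : Plane) : b ∈ closedTriangle a b c :=
  ⟨0, 1, 0, by simp, by simp, by simp, by simp, by simp⟩

theorem right_mem_closedTriangle (a b c : Plane) : c ∈ closedTriangle a b c :=
  ⟨0, 0, 1, by simp, by simp, by simp, by simp, by simp⟩

/-- The half-open segment from an interior point to a point of the closed triangle is interior. -/
theorem lineMap_mem_openTriangle {a b c q s : Plane} (hq : q ∈ openTriangle a b c)
    (hs : s ∈ closedTriangle a b c) {t : ℝ} (ht0 : 0 ≤ t) (ht : t < 1) :
    AffineMap.lineMap q s t ∈ openTriangle a b c := by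
  obtain ⟨a1, b1, c1, ha1, hb1, hc1, hs1, rfl⟩ := hq
  obtain ⟨a2, b2, c2, ha2, hb2, hc2, hs2, rfl⟩ := hs
  have h1 : 0 < 1 - t := by linarith
  refine ⟨(1 - t) * a1 + t * a2, (1 - t) * b1 + t * b2, (1 - t) * c1 + t * c2,
    by positivity, by positivity, by positivity, ?_, ?_⟩
  · linear_combination (1 - t) * hs1 + t * hs2
  · rw [AffineMap.lineMap_apply_module]; module

theorem openTriangle_rotate (a b c : Plane) : openTriangle b c a = openTriangle a b c := by
  ext x; constructor
  · rintro ⟨α, β, γ, h1, h2, h3, hs, rfl⟩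
    exact ⟨γ, α, β, h3, h1, h2, by linarith, by module⟩
  · rintro ⟨α, β, γ, h1, h2, h3, hs, rfl⟩
    exact ⟨β, γ, α, h2, h3, h1, by linarith, by module⟩

theorem openTriangle_swap (a b c : Plane) : openTriangle b a c = openTriangle a b c := by
  ext x; constructor <;>
  · rintro ⟨α, β, γ, h1, h2, h3, hs, rfl⟩
    exact ⟨β, α, γ, h2, h1, h3, by linarith, by module⟩

theorem closedTriangle_swap (a b c : Plane) : closedTriangle b a c = closedTriangle a b c := by
  ext x; constructor <;>
  · rintro ⟨α, β, γ, h1, h2, h3, hs, rfl⟩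
    exact ⟨β, α, γ, h2, h1, h3, by linarith, by module⟩

/-! ### Areas of triangles -/

open MeasureTheory

/-- The linear map sending the standard basis of the plane to `d`, `e`. -/
noncomputable def planeMap (d e : Plane) : Plane →ₗ[ℝ] Plane where
  toFun x := x 0 • d + x 1 • e
  map_add' x y := by simp only [PiLp.add_apply]; module
  map_smul' s x := by simp only [PiLp.smul_apply, smul_eq_mul, RingHom.id_apply]; module

theorem det_planeMap (d e : Plane) : LinearMap.det (planeMap d e) = d 0 * e 1 - d 1 * e 0 := by
  rw [← LinearMap.det_toMatrix (EuclideanSpace.basisFun (Fin 2) ℝ).toBasis, Matrix.det_fin_two]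
  simp [LinearMap.toMatrix_apply, planeMap]
  ring

/-- The standard open triangle. -/
def standardTriangle : Set Plane := {x | 0 < x 0 ∧ 0 < x 1 ∧ x 0 + x 1 < 1}

theorem openTriangle_eq_image (a b c : Plane) :
    openTriangle a b c = (fun x => a + x) '' (planeMap (b - a) (c - a) '' standardTriangle) := by
  ext x
  simp only [Set.mem_image, exists_exists_and_eq_and]
  constructor
  · rintro ⟨α, β, γ, h1, h2, h3, hs, rfl⟩
    refine ⟨!₂[β, γ], ⟨by simpa, by simpa, by simp; linarith⟩, ?_⟩
    obtain rfl : α = 1 - β - γ := by linarith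
    simp only [planeMap, LinearMap.coe_mk, AddHom.coe_mk]
    simp only [Matrix.cons_val_zero, Matrix.cons_val_one]
    module
  · rintro ⟨y, ⟨h1, h2, h3⟩, rfl⟩
    refine ⟨1 - y 0 - y 1, y 0, y 1, by linarith, h1, h2, by ring, ?_⟩
    simp only [planeMap, LinearMap.coe_mk, AddHom.coe_mk]
    module

/-- The area of the standard triangle stays unevaluated: it is a common factor in every comparison,
so only its being positive and finite matters. -/
theorem volume_openTriangle (a b c : Plane) :
    volume (openTriangle a b c) = ENNReal.ofReal |orient a b c| * volume standardTriangle := by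
  rw [openTriangle_eq_image, Set.image_add_left, measure_preimage_add,
    Measure.addHaar_image_linearMap, det_planeMap]
  simp only [orient, PiLp.sub_apply]

theorem volume_standardTriangle_ne_zero : volume standardTriangle ≠ 0 := by
  have hopen : IsOpen standardTriangle :=
    (isOpen_lt (f := fun _ : Plane => (0 : ℝ)) (g := fun x => x 0) (by fun_prop) (by fun_prop)).inter
      ((isOpen_lt (f := fun _ : Plane => (0 : ℝ)) (g := fun x => x 1) (by fun_prop)
        (by fun_prop)).inter (isOpen_lt (f := fun x : Plane => x 0 + x 1) (g := fun _ => (1 : ℝ))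
          (by fun_prop) (by fun_prop)))
  refine (hopen.measure_pos volume ⟨!₂[1/3, 1/3], ?_⟩).ne'
  norm_num [standardTriangle]

theorem volume_standardTriangle_ne_top : volume standardTriangle ≠ ⊤ := by
  refine (Bornology.IsBounded.measure_lt_top ?_).ne
  refine (Metric.isBounded_closedBall (x := (0 : Plane)) (r := 2)).subset ?_
  rintro x ⟨h1, h2, h3⟩
  rw [mem_closedBall_zero_iff, EuclideanSpace.norm_eq]
  apply Real.sqrt_le_iff.2
  simp only [Fin.sum_univ_two, Real.norm_eq_abs, sq_abs]
  constructor
  · norm_num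
  · nlinarith

theorem abs_orient_le_of_subset {a b c x y z : Plane}
    (h : openTriangle x y z ⊆ openTriangle a b c) : |orient x y z| ≤ |orient a b c| := by
  have := measure_mono (μ := volume) h
  rw [volume_openTriangle, volume_openTriangle, ENNReal.mul_le_mul_iff_left
    volume_standardTriangle_ne_zero volume_standardTriangle_ne_top] at this
  exact (ENNReal.ofReal_le_ofReal_iff (abs_nonneg _)).1 this

theorem abs_orient_add_le_of_disjoint {a b c x y z x' y' z' : Plane} (ho : orient x y z ≠ 0)
    (h : openTriangle x y z ⊆ openTriangle a b c) (h' : openTriangle x' y' z' ⊆ openTriangle a b c)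
    (hd : Disjoint (openTriangle x y z) (openTriangle x' y' z')) :
    |orient x y z| + |orient x' y' z'| ≤ |orient a b c| := by
  have := measure_mono (μ := volume) (Set.union_subset h h')
  rw [measure_union' hd (isOpen_openTriangle ho).measurableSet, volume_openTriangle,
    volume_openTriangle, volume_openTriangle, ← add_mul,
    ENNReal.mul_le_mul_iff_left volume_standardTriangle_ne_zero volume_standardTriangle_ne_top,
    ← ENNReal.ofReal_add (abs_nonneg _) (abs_nonneg _)] at this
  exact (ENNReal.ofReal_le_ofReal_iff (abs_nonneg _)).1 this

theorem exists_eq_lineMap_of_orient_eq_zero {a b c : Plane} (hab : a ≠ b) (h : orient a b c = 0) :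
    ∃ t : ℝ, c = a + t • (b - a) := by
  by_cases h0 : b 0 - a 0 = 0
  · have h1 : b 1 - a 1 ≠ 0 := fun h1 => hab (plane_ext (by linarith) (by linarith))
    refine ⟨(c 1 - a 1) / (b 1 - a 1), plane_ext ?_ ?_⟩
    · simp only [orient, h0, zero_mul, zero_sub, neg_eq_zero, mul_eq_zero, h1, false_or] at h
      simp [h0]; linarith
    · simp; field_simp; ring
  · refine ⟨(c 0 - a 0) / (b 0 - a 0), plane_ext ?_ ?_⟩
    · simp; field_simp; ring
    · simp; field_simp; simp only [orient] at h; linarith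

/-! ### Triangles in a planar drawing are nested or have disjoint interiors -/

/-- `x` is a common neighbour of the endpoints of the edge `uv`. -/
def IsTri {V : Type} (G : SimpleGraph V) (u v x : V) : Prop := G.Adj u v ∧ G.Adj u x ∧ G.Adj v x

theorem IsTri.rotate {V : Type} {G : SimpleGraph V} {a b c : V} (h : IsTri G a b c) : IsTri G b c a :=
  ⟨h.2.2, h.1.symm, h.2.1.symm⟩

theorem IsTri.swap {V : Type} {G : SimpleGraph V} {a b c : V} (h : IsTri G a b c) : IsTri G b a c :=
  ⟨h.1.symm, h.2.2, h.2.1⟩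

namespace IsPlanarStraightLineDrawing

variable {V : Type} {G : SimpleGraph V} {p : V → Plane}

/-- If the points were collinear, one of the vertices would lie on the edge joining the other two;
the position of t relative to 0 and 1 tells which. -/
theorem orient_ne_zero_of_adj (hp : IsPlanarStraightLineDrawing G p) {u v w : V} (huv : G.Adj u v)
    (huw : G.Adj u w) (hvw : G.Adj v w) : orient (p u) (p v) (p w) ≠ 0 := by
  intro h
  obtain ⟨t, ht⟩ := exists_eq_lineMap_of_orient_eq_zero (hp.injective.ne huv.ne) h
  rcases lt_trichotomy t 0 with h0 | rfl | h0
  · refine hp.vertex_notMem v w u hvw huv.ne huw.ne ⟨-t / (1 - t), 1 / (1 - t),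
      div_nonneg (by linarith) (by linarith), div_nonneg (by linarith) (by linarith), ?_, ?_⟩
    · have : 1 - t ≠ 0 := by linarith
      field_simp; ring
    · have h1 : 1 - t ≠ 0 := by linarith
      rw [ht]
      have : p u = ((1 - t) / (1 - t)) • p u := by rw [div_self h1, one_smul]
      conv_rhs => rw [this]
      simp only [div_eq_mul_inv]; module
  · simp only [zero_smul, add_zero] at ht
    exact huw.ne (hp.injective ht).symm
  · rcases le_or_gt t 1 with h1 | h1
    · refine hp.vertex_notMem u v w huv huw.ne' hvw.ne' ⟨1 - t, t, by linarith, h0.le, by ring, ?_⟩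
      rw [ht]; module
    · refine hp.vertex_notMem u w v huw huv.ne' hvw.ne ⟨1 - 1 / t, 1 / t, ?_, by positivity,
        by ring, ?_⟩
      · rw [sub_nonneg, div_le_one h0]; exact h1.le
      · rw [ht]
        have : p v = (1 / t * t) • p v := by rw [one_div_mul_cancel h0.ne', one_smul]
        conv_rhs => rw [this]
        have : p u = (1 / t * t) • p u := by rw [one_div_mul_cancel h0.ne', one_smul]
        rw [smul_add, smul_smul, smul_sub]
        nth_rw 3 [this]
        simp only [sub_smul, one_smul, one_div_mul_cancel h0.ne']
        module

theorem orient_ne_zero (hp : IsPlanarStraightLineDrawing G p) {a b c : V} (h : IsTri G a b c) :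
    orient (p a) (p b) (p c) ≠ 0 :=
  hp.orient_ne_zero_of_adj h.1 h.2.1 h.2.2

/-- A vertex of a closed drawn triangle is interior or a corner. -/
theorem mem_openTriangle_or_eq (hp : IsPlanarStraightLineDrawing G p) {a b c x : V}
    (h : IsTri G a b c) (hx : p x ∈ closedTriangle (p a) (p b) (p c)) :
    p x ∈ openTriangle (p a) (p b) (p c) ∨ x = a ∨ x = b ∨ x = c := by
  by_contra! hcon
  obtain ⟨h0, ha, hb, hc⟩ := hcon
  rcases mem_side_of_mem_closedTriangle hx h0 with h1 | h1 | h1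
  · exact hp.vertex_notMem _ _ _ h.1 ha hb h1
  · exact hp.vertex_notMem _ _ _ h.2.2 hb hc h1
  · exact hp.vertex_notMem _ _ _ h.2.1.symm hc ha h1

/-- The working form of planarity: a point interior to st is not a vertex, so contact at an end of
ef is excluded as well. -/
theorem eq_of_openSegment_meets_segment (hp : IsPlanarStraightLineDrawing G p) {s t e f : V}
    (hst : G.Adj s t) (hef : G.Adj e f) {z : Plane} (hz : z ∈ openSegment ℝ (p s) (p t))
    (hz' : z ∈ segment ℝ (p e) (p f)) : s(s, t) = s(e, f) := by
  have hne : ∀ {x}, x = s ∨ x = t → p x ≠ z := by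
    rintro x (rfl | rfl) rfl
    · exact hst.ne (hp.injective (left_mem_openSegment_iff.1 hz))
    · exact hst.ne (hp.injective (right_mem_openSegment_iff.1 hz))
  by_contra hcon
  have hv : ∀ x, p x = z → False := by
    rintro x rfl
    exact hp.vertex_notMem s t x hst (fun h => hne (.inl h) rfl) (fun h => hne (.inr h) rfl)
      (openSegment_subset_segment _ _ _ hz)
  rcases eq_or_ne (p e) z with h | he
  · exact hv e h
  rcases eq_or_ne (p f) z with h | hf
  · exact hv f h
  exact Set.disjoint_left.1 (hp.edges_disjoint s t e f hst hef hcon) hz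
    (mem_openSegment_of_ne_left_right he hf hz')

/-- An edge that meets the interior of a drawn triangle stays inside the triangle. -/
theorem end_mem_closedTriangle (hp : IsPlanarStraightLineDrawing G p) {a b c s t : V}
    (h : IsTri G a b c) (hst : G.Adj s t) {q : Plane} (hq : q ∈ segment ℝ (p s) (p t))
    (hq' : q ∈ openTriangle (p a) (p b) (p c)) :
    p t ∈ closedTriangle (p a) (p b) (p c) := by
  have ho := hp.orient_ne_zero h
  by_contra ht
  have ht' : p t ∉ openTriangle (p a) (p b) (p c) :=
    fun h' => ht (openTriangle_subset_closedTriangle _ _ _ h')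
  -- On the way from q to t the edge leaves the triangle at a point z of a side. As z is interior to
  -- st, planarity identifies st with that side, which misses q.
  obtain ⟨τ, hτ0, hτ1, hcl, hside⟩ := exists_mem_side_of_exit ho hq' ht'
  set z := AffineMap.lineMap q (p t) τ
  have hτ : τ < 1 := by
    refine lt_of_le_of_ne hτ1 ?_
    rintro rfl
    apply ht
    simpa [z] using hcl
  have hz : z ∈ openSegment ℝ (p s) (p t) := by
    obtain ⟨α, β, hα, hβ, hs, rfl⟩ := hq
    rcases hα.eq_or_lt with rfl | hα
    · obtain rfl : β = 1 := by linarith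
      simp only [zero_smul, one_smul, zero_add] at hq'
      exact absurd hq' ht'
    · refine ⟨(1 - τ) * α, (1 - τ) * β + τ, mul_pos (by linarith) hα,
        add_pos_of_nonneg_of_pos (mul_nonneg (by linarith) hβ) hτ0, ?_, ?_⟩
      · linear_combination (1 - τ) * hs
      · simp only [z]; rw [AffineMap.lineMap_apply_module]; module
  have key : ∀ e f, G.Adj e f → z ∈ segment ℝ (p e) (p f) →
      ¬ (q ∈ segment ℝ (p e) (p f)) → False := by
    intro e f hef hzef hqef
    have := hp.eq_of_openSegment_meets_segment hst hef hz hzef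
    rw [Sym2.eq_iff] at this
    rcases this with ⟨rfl, rfl⟩ | ⟨rfl, rfl⟩
    · exact hqef hq
    · exact hqef (segment_symm ℝ (p s) (p t) ▸ hq)
  have hside' := fun hx => side_disjoint_openTriangle (x := q) ho hx hq'
  rcases hside with h1 | h1 | h1
  · exact key _ _ h.1 h1 fun h' => hside' (.inl h')
  · exact key _ _ h.2.2 h1 fun h' => hside' (.inr (.inl h'))
  · exact key _ _ h.2.1.symm h1 fun h' => hside' (.inr (.inr h'))

/-- Neighbours of a vertex in the interior of a drawn triangle are in the closed triangle. -/
theorem neighbor_mem_closedTriangle (hp : IsPlanarStraightLineDrawing G p) {a b c s t : V}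
    (h : IsTri G a b c) (hst : G.Adj s t) (hs : p s ∈ openTriangle (p a) (p b) (p c)) :
    p t ∈ closedTriangle (p a) (p b) (p c) :=
  hp.end_mem_closedTriangle h hst (left_mem_segment ℝ _ _) hs

/-- The ends of xy are not both corners of abc, as xy would then be a side and miss the interior. So
one end is interior, and z is its neighbour. -/
theorem closed_of_edge_meets (hp : IsPlanarStraightLineDrawing G p) {a b c x y z : V}
    (h : IsTri G a b c) (h' : IsTri G x y z) {q : Plane} (hq : q ∈ segment ℝ (p x) (p y))
    (hq' : q ∈ openTriangle (p a) (p b) (p c)) :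
    p x ∈ closedTriangle (p a) (p b) (p c) ∧ p y ∈ closedTriangle (p a) (p b) (p c) ∧
      p z ∈ closedTriangle (p a) (p b) (p c) := by
  have hx := hp.end_mem_closedTriangle h h'.1.symm (segment_symm ℝ (p x) (p y) ▸ hq) hq'
  have hy := hp.end_mem_closedTriangle h h'.1 hq hq'
  refine ⟨hx, hy, ?_⟩
  rcases hp.mem_openTriangle_or_eq h hx with h1 | h1
  · exact hp.neighbor_mem_closedTriangle h h'.2.1 h1
  rcases hp.mem_openTriangle_or_eq h hy with h2 | h2
  · exact hp.neighbor_mem_closedTriangle h h'.2.2 h2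
  exfalso
  have hside := fun hx => side_disjoint_openTriangle (x := q) (hp.orient_ne_zero h) hx hq'
  have hq2 := segment_symm ℝ (p x) (p y) ▸ hq
  have hne := h'.1.ne
  rcases h1 with rfl | rfl | rfl <;> rcases h2 with rfl | rfl | rfl <;> tauto

/-- Two drawn triangles whose interiors meet are nested. -/
theorem nested_of_interiors_meet (hp : IsPlanarStraightLineDrawing G p) {a b c x y z : V}
    (h : IsTri G a b c) (h' : IsTri G x y z) {q : Plane}
    (hq : q ∈ openTriangle (p a) (p b) (p c)) (hq' : q ∈ openTriangle (p x) (p y) (p z)) :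
    (p x ∈ closedTriangle (p a) (p b) (p c) ∧ p y ∈ closedTriangle (p a) (p b) (p c) ∧
      p z ∈ closedTriangle (p a) (p b) (p c)) ∨
    (p a ∈ closedTriangle (p x) (p y) (p z) ∧ p b ∈ closedTriangle (p x) (p y) (p z) ∧
      p c ∈ closedTriangle (p x) (p y) (p z)) := by
  by_cases hm : ∃ z', z' ∈ openTriangle (p a) (p b) (p c) ∧
      (z' ∈ segment ℝ (p x) (p y) ∨ z' ∈ segment ℝ (p y) (p z) ∨ z' ∈ segment ℝ (p z) (p x))
  · left
    obtain ⟨z', h1, h2 | h2 | h2⟩ := hm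
    · exact hp.closed_of_edge_meets h h' h2 h1
    · have := hp.closed_of_edge_meets h h'.rotate h2 h1; tauto
    · have := hp.closed_of_edge_meets h h'.rotate.rotate h2 h1; tauto
  · right
    -- No side of xyz enters the interior of abc, so a walk from q to a point d of abc cannot leave
    -- xyz before reaching d.
    have key : ∀ d, d ∈ closedTriangle (p a) (p b) (p c) → d ∈ closedTriangle (p x) (p y) (p z) := by
      intro d hd
      by_contra hcon
      obtain ⟨t, ht0, ht1, hcl, hs⟩ := exists_mem_side_of_exit (hp.orient_ne_zero h') hq'
        (fun h0 => hcon (openTriangle_subset_closedTriangle _ _ _ h0))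
      rcases ht1.eq_or_lt with rfl | ht1
      · rw [AffineMap.lineMap_apply_one] at hcl; exact hcon hcl
      · exact hm ⟨_, lineMap_mem_openTriangle hq hd ht0.le ht1, hs⟩
    exact ⟨key _ (left_mem_closedTriangle _ _ _), key _ (mid_mem_closedTriangle _ _ _),
      key _ (right_mem_closedTriangle _ _ _)⟩

/-- Of two triangles on the same side of a common edge, one has its apex inside the other. -/
theorem apex_nested (hp : IsPlanarStraightLineDrawing G p) {u v x y : V}
    (hx : IsTri G u v x) (hy : IsTri G u v y) (hxy : x ≠ y)
    (hside : 0 < orient (p u) (p v) (p x) / orient (p u) (p v) (p y)) :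
    p x ∈ openTriangle (p u) (p v) (p y) ∨ p y ∈ openTriangle (p u) (p v) (p x) := by
  obtain ⟨α, β, γ, hs, hc⟩ := exists_barycentric (hp.orient_ne_zero hy) (p x)
  have hγ : 0 < γ := by
    rw [hc, orient_combo_right _ _ _ hs, mul_div_assoc, div_self (hp.orient_ne_zero hy),
      mul_one] at hside
    exact hside
  -- The midpoint of uv, moved towards x with weight 1/M, is interior to both triangles: M is so
  -- large that the weights of u and v, near 1/2, stay positive.
  set M := 8 * (1 + |α| + |β|)
  have hM : 0 < M := by positivity
  have h1 : 1 / M ≤ 1 / 8 := by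
    apply one_div_le_one_div_of_le (by norm_num)
    have := abs_nonneg α; have := abs_nonneg β; simp only [M]; linarith
  have h2 : ∀ δ, |δ| ≤ |α| + |β| → -(1 / 8) ≤ 1 / M * δ := by
    intro δ hδ
    have : 1 / M * |δ| ≤ 1 / 8 := by
      rw [one_div_mul_eq_div, div_le_iff₀ hM]; simp only [M]; linarith
    have h3 := neg_abs_le δ
    have : 1 / M * (-|δ|) ≤ 1 / M * δ := mul_le_mul_of_nonneg_left h3 (by positivity)
    linarith
  have hα := h2 α (by linarith [abs_nonneg β])
  have hβ := h2 β (by linarith [abs_nonneg α])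
  have hq : ((1 - 1 / M) / 2) • p u + ((1 - 1 / M) / 2) • p v + (1 / M) • p x ∈
      openTriangle (p u) (p v) (p x) :=
    ⟨_, _, _, by linarith, by linarith, by positivity, by ring, rfl⟩
  have hq' : ((1 - 1 / M) / 2) • p u + ((1 - 1 / M) / 2) • p v + (1 / M) • p x ∈
      openTriangle (p u) (p v) (p y) := by
    refine ⟨(1 - 1 / M) / 2 + 1 / M * α, (1 - 1 / M) / 2 + 1 / M * β, 1 / M * γ,
      by linarith, by linarith, by positivity, by linear_combination (1 / M) * hs, ?_⟩
    rw [hc]; module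
  rcases hp.nested_of_interiors_meet hx hy hq hq' with ⟨-, -, h⟩ | ⟨-, -, h⟩
  · right
    rcases hp.mem_openTriangle_or_eq hx h with h | rfl | rfl | rfl
    · exact h
    · exact absurd rfl hy.2.1.ne
    · exact absurd rfl hy.2.2.ne
    · exact absurd rfl hxy
  · left
    rcases hp.mem_openTriangle_or_eq hy h with h | rfl | rfl | rfl
    · exact h
    · exact absurd rfl hx.2.1.ne
    · exact absurd rfl hx.2.2.ne
    · exact absurd rfl hxy

end IsPlanarStraightLineDrawing

/-! ### Chains of nested triangles and halving of area -/

/-- The endpoints of the edge `uv` have five common neighbours other than `a`, the edges to these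
have again five such vertices each, avoiding the opposite corner, and so on, `n` times. -/
def Deep {V : Type} (G : SimpleGraph V) : ℕ → V → V → V → Prop
  | 0, u, v, _ => G.Adj u v
  | n + 1, u, v, a => G.Adj u v ∧ ∃ w : Fin 5 → V, Function.Injective w ∧
      ∀ j, w j ≠ a ∧ Deep G n u (w j) v ∧ Deep G n v (w j) u

theorem Deep.adj {V : Type} {G : SimpleGraph V} {n : ℕ} {u v a : V} (h : Deep G n u v a) :
    G.Adj u v := by
  cases n
  · exact h
  · exact h.1

/-- Three nested triangles on the edge `uv`, with `n` further stages on the inner edges. -/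
structure Chain {V : Type} (G : SimpleGraph V) (p : V → Plane) (n : ℕ) (u v x y z : V) : Prop where
  outer : IsTri G u v x
  middle : IsTri G u v y
  inner : IsTri G u v z
  mem_outer : p y ∈ openTriangle (p u) (p v) (p x)
  mem_middle : p z ∈ openTriangle (p u) (p v) (p y)
  deep_middle : Deep G n u y v ∧ Deep G n v y u
  deep_inner : Deep G n u z v ∧ Deep G n v z u

/-- A corner is an extreme point: its own barycentric coordinate is below 1 at every other point of
the triangle, hence at convex combinations of such points. -/
theorem corner_notMem_closedTriangle {a b c x y z : Plane} (ho : orient a b c ≠ 0)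
    (hx : x ∈ closedTriangle a b c) (hy : y ∈ closedTriangle a b c) (hz : z ∈ closedTriangle a b c)
    (hxa : x ≠ a) (hya : y ≠ a) (hza : z ≠ a) : a ∉ closedTriangle x y z := by
  have key : ∀ w, w ∈ closedTriangle a b c → w ≠ a → orient w b c / orient a b c < 1 := by
    rintro w ⟨α, β, γ, h1, h2, h3, hs, rfl⟩ hne
    rw [orient_combo_left _ _ _ hs, mul_div_assoc, div_self ho, mul_one]
    by_contra hcon
    obtain rfl : β = 0 := by linarith
    obtain rfl : γ = 0 := by linarith
    obtain rfl : α = 1 := by linarith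
    exact hne (by simp)
  have hx := key x hx hxa
  have hy := key y hy hya
  have hz := key z hz hza
  rintro ⟨α, β, γ, h1, h2, h3, hs, ha⟩
  have : orient a b c = α * orient x b c + β * orient y b c + γ * orient z b c := by
    nth_rw 1 [ha]
    obtain rfl : α = 1 - β - γ := by linarith
    simp only [orient, PiLp.add_apply, PiLp.smul_apply, smul_eq_mul]; ring
  have h4 : 1 = α * (orient x b c / orient a b c) + β * (orient y b c / orient a b c) +
      γ * (orient z b c / orient a b c) := by
    field_simp; exact this
  have e1 := mul_le_mul_of_nonneg_left hx.le h1
  have e2 := mul_le_mul_of_nonneg_left hy.le h2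
  have e3 := mul_le_mul_of_nonneg_left hz.le h3
  rcases h1.eq_or_lt with rfl | h1
  · rcases h2.eq_or_lt with rfl | h2
    · nlinarith
    · nlinarith
  · nlinarith

theorem Chain.swap {V : Type} {G : SimpleGraph V} {p : V → Plane} {n : ℕ} {u v x y z : V}
    (h : Chain G p n u v x y z) : Chain G p n v u x y z :=
  ⟨h.outer.swap, h.middle.swap, h.inner.swap, openTriangle_swap (p u) (p v) _ ▸ h.mem_outer,
    openTriangle_swap (p u) (p v) _ ▸ h.mem_middle, h.deep_middle.symm, h.deep_inner.symm⟩

namespace IsPlanarStraightLineDrawing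

variable {V : Type} {G : SimpleGraph V} {p : V → Plane}

/-- Pigeonhole: five apexes and two sides of uv give three on one side, and these are pairwise
nested. -/
theorem exists_chain (hp : IsPlanarStraightLineDrawing G p) {n : ℕ} {u v a : V}
    (h : Deep G (n + 1) u v a) : ∃ x y z, Chain G p n u v x y z ∧ x ≠ a := by
  obtain ⟨huv, w, hw, hd⟩ := h
  have htri : ∀ j, IsTri G u v (w j) := fun j => ⟨huv, (hd j).2.1.adj, (hd j).2.2.adj⟩
  let f : Fin 5 → Bool := fun j => decide (0 < orient (p u) (p v) (p (w j)))
  obtain ⟨b, hb⟩ := Fintype.exists_lt_card_fiber_of_mul_lt_card (f := f) (n := 2) (by simp)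
  obtain ⟨i, hi, j, hj, k, hk, hij, hik, hjk⟩ := Finset.two_lt_card.1 hb
  simp only [Finset.mem_filter, Finset.mem_univ, true_and] at hi hj hk
  have side : ∀ s t, f s = f t →
      0 < orient (p u) (p v) (p (w s)) / orient (p u) (p v) (p (w t)) := by
    intro s t hst
    have hs := hp.orient_ne_zero (htri s)
    have ht := hp.orient_ne_zero (htri t)
    simp only [f, decide_eq_decide] at hst
    rcases hs.lt_or_gt with hs | hs
    · exact div_pos_of_neg_of_neg hs (lt_of_le_of_ne (not_lt.1 (mt hst.2 hs.not_gt)) ht)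
    · exact div_pos hs (hst.1 hs)
  have nest : ∀ s t, f s = f t → s ≠ t →
      p (w s) ∈ openTriangle (p u) (p v) (p (w t)) ∨
        p (w t) ∈ openTriangle (p u) (p v) (p (w s)) :=
    fun s t h1 h2 => hp.apex_nested (htri s) (htri t) (hw.ne h2) (side s t h1)
  have mk : ∀ s t q, p (w t) ∈ openTriangle (p u) (p v) (p (w s)) →
      p (w q) ∈ openTriangle (p u) (p v) (p (w t)) →
        ∃ x y z, Chain G p n u v x y z ∧ x ≠ a :=
    fun s t q h1 h2 => ⟨w s, w t, w q, ⟨htri s, htri t, htri q, h1, h2, (hd t).2, (hd q).2⟩,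
      (hd s).1⟩
  -- The cyclic patterns need no refutation, since a chain asks only for two consecutive
  -- memberships.
  rcases nest i j (hi.trans hj.symm) hij with h1 | h1 <;>
  rcases nest j k (hj.trans hk.symm) hjk with h2 | h2 <;>
  rcases nest i k (hi.trans hk.symm) hik with h3 | h3
  · exact mk k j i h2 h1
  · exact mk k j i h2 h1
  · exact mk j k i h2 h3
  · exact mk j i k h1 h3
  · exact mk k i j h3 h1
  · exact mk i k j h3 h2
  · exact mk i j k h1 h2
  · exact mk i j k h1 h2

/-- On one of the two middle edges of a chain there is a chain of at most half the area. -/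
theorem exists_chain_half (hp : IsPlanarStraightLineDrawing G p) {n : ℕ} {u v x y z : V}
    (h : Chain G p (n + 1) u v x y z) : ∃ u' v' x' y' z', Chain G p n u' v' x' y' z' ∧
      2 * |orient (p u') (p v') (p x')| ≤ |orient (p u) (p v) (p x)| := by
  obtain ⟨a1, a2, a3, ha, hav⟩ := hp.exists_chain h.deep_middle.1
  obtain ⟨b1, b2, b3, hb, hbu⟩ := hp.exists_chain h.deep_middle.2
  have ho := hp.orient_ne_zero h.outer
  have ho' : orient (p v) (p u) (p x) ≠ 0 := hp.orient_ne_zero h.outer.swap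
  have hu := left_mem_closedTriangle (p u) (p v) (p x)
  have hv := mid_mem_closedTriangle (p u) (p v) (p x)
  have hy := openTriangle_subset_closedTriangle _ _ _ h.mem_outer
  have ha1 := hp.neighbor_mem_closedTriangle h.outer ha.outer.2.2 h.mem_outer
  have hb1 := hp.neighbor_mem_closedTriangle h.outer hb.outer.2.2 h.mem_outer
  have inj : ∀ {s t : V}, s ≠ t → p s ≠ p t := fun h => hp.injective.ne h
  have hne : ∀ {s t : V}, G.Adj s t → p s ≠ p t := fun h => hp.injective.ne h.ne
  -- If the interiors met, nesting would put v into the triangle on uy or u into the one on vy,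
  -- though u and v are corners of uvx, which contains both. This needs a1 ≠ v and b1 ≠ u, which is
  -- why `Deep` records the opposite corner.
  have hdisj : Disjoint (openTriangle (p u) (p y) (p a1)) (openTriangle (p v) (p y) (p b1)) := by
    rw [Set.disjoint_left]
    intro q hq hq'
    rcases hp.nested_of_interiors_meet ha.outer hb.outer hq hq' with ⟨h1, -, -⟩ | ⟨h1, -, -⟩
    · refine corner_notMem_closedTriangle ho' ?_ ?_ ?_ (hne h.outer.1) (hne h.middle.2.2.symm)
        (inj hav) h1 <;> rwa [closedTriangle_swap]
    · exact corner_notMem_closedTriangle ho hv hy hb1 (hne h.outer.1.symm)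
        (hne h.middle.2.1.symm) (inj hbu) h1
  have hsum := abs_orient_add_le_of_disjoint (hp.orient_ne_zero ha.outer)
    (openTriangle_subset_openTriangle hu h.mem_outer ha1)
    (openTriangle_subset_openTriangle hv h.mem_outer hb1) hdisj
  rcases le_total |orient (p u) (p y) (p a1)| |orient (p v) (p y) (p b1)| with hle | hle
  · exact ⟨u, y, a1, a2, a3, ha, by linarith⟩
  · exact ⟨v, y, b1, b2, b3, hb, by linarith⟩

end IsPlanarStraightLineDrawing

/-! ### Flat triangles and projection to the longest side -/

theorem plane_dist_sq (x y : Plane) : dist x y ^ 2 = (x 0 - y 0) ^ 2 + (x 1 - y 1) ^ 2 := by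
  rw [EuclideanSpace.dist_eq, Real.sq_sqrt (by positivity), Fin.sum_univ_two,
    Real.dist_eq, Real.dist_eq, sq_abs, sq_abs]

theorem abs_orient_le_mul_dist (a b c : Plane) : |orient a b c| ≤ dist a b * dist a c := by
  apply abs_le_of_sq_le_sq _ (by positivity)
  rw [mul_pow, plane_dist_sq, plane_dist_sq]
  have := sq_nonneg ((b 0 - a 0) * (c 0 - a 0) + (b 1 - a 1) * (c 1 - a 1))
  simp only [orient]
  nlinarith

/-- In a flat triangle with longest side `ab`, the distances are nearly those of the projections
to `ab`. -/
theorem exists_projection {a b c : Plane} (hD : 1 ≤ dist a b) (hac : dist a c ≤ dist a b)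
    (hbc : dist b c ≤ dist a b) (ho : |orient a b c| ≤ 1 / 4) :
    ∃ ξ : Plane → ℝ, ξ a = 0 ∧ ξ b = dist a b ∧
      (∀ x ∈ closedTriangle a b c, 0 ≤ ξ x ∧ ξ x ≤ dist a b) ∧
      (∀ x ∈ closedTriangle a b c, ∀ y ∈ closedTriangle a b c,
        dist x y ≤ |ξ x - ξ y| + 1 / 4) ∧
      ∀ (x y z : Plane) (α β γ : ℝ), α + β + γ = 1 →
        ξ (α • x + β • y + γ • z) = α * ξ x + β * ξ y + γ * ξ z := by
  set D := dist a b
  have hD2 : D ^ 2 = (a 0 - b 0) ^ 2 + (a 1 - b 1) ^ 2 := plane_dist_sq a b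
  have hD0 : 0 < D := by linarith
  -- The coordinate along ab, measured from a. The height over ab is `orient a b x / D`, so `hdist`
  -- below is Pythagoras multiplied by D^2.
  let ξ : Plane → ℝ := fun x => ((x 0 - a 0) * (b 0 - a 0) + (x 1 - a 1) * (b 1 - a 1)) / D
  have hξ : ∀ x, D * ξ x = (x 0 - a 0) * (b 0 - a 0) + (x 1 - a 1) * (b 1 - a 1) := by
    intro x; simp only [ξ]; field_simp
  have hξa : ξ a = 0 := by simp [ξ]
  have hξb : ξ b = D := by
    apply mul_left_cancel₀ hD0.ne'; rw [hξ]; nlinarith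
  have hdist : ∀ x y, D ^ 2 * dist x y ^ 2 =
      (D * (ξ x - ξ y)) ^ 2 + (orient a b x - orient a b y) ^ 2 := by
    intro x y
    rw [mul_sub, hξ, hξ, hD2, plane_dist_sq x y]; simp only [orient]; ring
  have haff : ∀ (x y z : Plane) (α β γ : ℝ), α + β + γ = 1 →
      ξ (α • x + β • y + γ • z) = α * ξ x + β * ξ y + γ * ξ z := by
    intro x y z α β γ h
    obtain rfl : α = 1 - β - γ := by linarith
    simp only [ξ, PiLp.add_apply, PiLp.smul_apply, smul_eq_mul]; ring
  have hξle : ∀ x y, |ξ x - ξ y| ≤ dist x y := by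
    intro x y
    apply abs_le_of_sq_le_sq _ dist_nonneg
    have := hdist x y
    have h2 := sq_nonneg (orient a b x - orient a b y)
    have : D ^ 2 * (ξ x - ξ y) ^ 2 ≤ D ^ 2 * dist x y ^ 2 := by rw [this]; nlinarith
    exact le_of_mul_le_mul_left this (by positivity)
  have hξc : 0 ≤ ξ c ∧ ξ c ≤ D := by
    have h1 := (hξle a c).trans hac
    have h2 := (hξle b c).trans hbc
    rw [abs_le] at h1 h2
    rw [hξa] at h1; rw [hξb] at h2
    constructor <;> linarith
  refine ⟨ξ, hξa, hξb, ?_, ?_, haff⟩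
  · rintro _ ⟨α, β, γ, h1, h2, h3, hs, rfl⟩
    rw [haff _ _ _ _ _ _ hs, hξa, hξb]
    have e1 := mul_le_mul_of_nonneg_left hξc.2 h3
    have e2 := mul_nonneg h3 hξc.1
    have e3 := mul_nonneg h2 hD0.le
    have e4 := mul_nonneg h1 hD0.le
    constructor
    · linarith
    · have : D = α * D + β * D + γ * D := by rw [← add_mul, ← add_mul, hs, one_mul]
      linarith
  · intro x hx y hy
    have hh : |orient a b x - orient a b y| ≤ 1 / 4 := by
      obtain ⟨α, β, γ, h1, h2, h3, hs, rfl⟩ := hx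
      obtain ⟨α', β', γ', h1', h2', h3', hs', rfl⟩ := hy
      rw [orient_combo_right _ _ _ hs, orient_combo_right _ _ _ hs', ← sub_mul, abs_mul]
      have : |γ - γ'| ≤ 1 := by rw [abs_le]; constructor <;> linarith
      nlinarith [abs_nonneg (orient a b c)]
    have h0 := abs_nonneg (ξ x - ξ y)
    apply le_of_sq_le_sq _ (by positivity)
    have h1 := hdist x y
    have h2 : (orient a b x - orient a b y) ^ 2 ≤ D ^ 2 * (1 / 4) ^ 2 := by
      rw [← sq_abs]
      have : |orient a b x - orient a b y| ^ 2 ≤ (1 / 4) ^ 2 := by gcongr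
      nlinarith
    have h3 : D ^ 2 * dist x y ^ 2 ≤ D ^ 2 * (|ξ x - ξ y| + 1 / 4) ^ 2 := by
      rw [h1, add_sq, sq_abs]
      have : 0 ≤ D ^ 2 * (2 * |ξ x - ξ y| * (1 / 4)) := by positivity
      nlinarith
    exact le_of_mul_le_mul_left h3 (by positivity)

theorem orient_combo_ratio_lt_one {a b c x : Plane} (hx : x ∈ openTriangle a b c) :
    ∃ γ : ℝ, 0 < γ ∧ γ < 1 ∧ orient a b x = γ * orient a b c := by
  obtain ⟨α, β, γ, h1, h2, h3, hs, rfl⟩ := hx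
  exact ⟨γ, h3, by linarith, orient_combo_right _ _ _ hs⟩

namespace IsPlanarStraightLineDrawing

variable {V : Type} {G : SimpleGraph V} {p : V → Plane}

/-- If a neighbour `w` of `v` and `y` lies on the same side of `uv` as `z`, then it is, as seen from
`u`, beyond the line `vz`. -/
theorem opposite_coord_neg (hp : IsPlanarStraightLineDrawing G p) {u v x y z w : V}
    (hx : IsTri G u v x) (hy : IsTri G u v y) (hz : IsTri G u v z)
    (hyx : p y ∈ openTriangle (p u) (p v) (p x)) (hzy : p z ∈ openTriangle (p u) (p v) (p y))
    (hw : IsTri G v y w) (hwu : w ≠ u) (hwz : w ≠ z) {α β γ : ℝ} (hs : α + β + γ = 1)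
    (hc : p w = α • p u + β • p v + γ • p z) : α < 0 ∧ 0 < γ := by
  have hwx : p w ∈ closedTriangle (p u) (p v) (p x) :=
    hp.neighbor_mem_closedTriangle hx hw.2.2 hyx
  obtain ⟨g1, hg1, hg1', h1⟩ := orient_combo_ratio_lt_one hyx
  obtain ⟨g2, hg2, hg2', h2⟩ := orient_combo_ratio_lt_one hzy
  have hox := hp.orient_ne_zero hx
  have hoy := hp.orient_ne_zero hy
  -- γ is the ratio of the heights of w and z over uv. Both are on the side of x, because w lies in
  -- uvx but not on uv.
  have hγ : 0 < γ := by
    obtain ⟨α', β', γ', h1', h2', h3', hs', hc'⟩ := hwx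
    have hγ' : 0 < γ' := by
      refine lt_of_le_of_ne h3' ?_
      rintro rfl
      refine hp.vertex_notMem u v w hx.1 hwu hw.2.1.ne' ⟨α', β', h1', h2', by linarith, ?_⟩
      rw [hc']; simp
    have h3 := orient_combo_right (p u) (p v) (p z) hs
    have h4 := orient_combo_right (p u) (p v) (p x) hs'
    rw [← hc] at h3
    rw [← hc', h3, h2, h1, ← mul_assoc, ← mul_assoc] at h4
    have h5 := mul_right_cancel₀ hox h4
    have : 0 < g2 * g1 := by positivity
    rw [mul_assoc] at h5
    by_contra hcon
    have := mul_nonpos_of_nonpos_of_nonneg (not_lt.1 hcon) this.le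
    linarith
  refine ⟨?_, hγ⟩
  by_contra! hα
  -- With α ≥ 0, either w is inside uvz and so is its neighbour y, although y is higher over uv than
  -- z; or β < 0 and the edges wv and uz cross.
  rcases le_or_gt 0 β with hβ | hβ
  · have hwin : p w ∈ closedTriangle (p u) (p v) (p z) := ⟨α, β, γ, hα, hβ, hγ.le, hs, hc⟩
    rcases hp.mem_openTriangle_or_eq hz hwin with h | h | h | h
    · obtain ⟨α', β', γ', h1', h2', h3', hs', hc'⟩ :=
        hp.neighbor_mem_closedTriangle hz hw.2.2.symm h
      have h3 := orient_combo_right (p u) (p v) (p z) hs'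
      rw [← hc', h2, ← mul_assoc] at h3
      have : (1 : ℝ) = γ' * g2 := mul_right_cancel₀ hoy (by rw [one_mul]; exact h3)
      nlinarith
    · exact hwu h
    · exact hw.2.1.ne' h
    · exact hwz h
  · have hb : 0 < 1 - β := by linarith
    have hz1 : (1 / (1 - β)) • p w + (-β / (1 - β)) • p v =
        (α / (1 - β)) • p u + (γ / (1 - β)) • p z := by
      rw [hc]
      simp only [div_eq_mul_inv]
      module
    have hmem : (1 / (1 - β)) • p w + (-β / (1 - β)) • p v ∈ openSegment ℝ (p w) (p v) :=
      ⟨_, _, by positivity, div_pos (by linarith) hb, by field_simp; ring, rfl⟩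
    have hmem' : (1 / (1 - β)) • p w + (-β / (1 - β)) • p v ∈ segment ℝ (p u) (p z) := by
      rw [hz1]
      exact ⟨_, _, by positivity, by positivity, by field_simp; linarith, rfl⟩
    have := hp.eq_of_openSegment_meets_segment hw.2.1.symm hz.2.1 hmem hmem'
    rw [Sym2.eq_iff] at this
    rcases this with ⟨h, -⟩ | ⟨h, -⟩
    · exact hwu h
    · exact hwz h

end IsPlanarStraightLineDrawing

/-- The length of the longest side of a triangle. -/
noncomputable def longestSide (a b c : Plane) : ℝ := max (dist a b) (max (dist a c) (dist b c))

theorem longestSide_swap (a b c : Plane) : longestSide b a c = longestSide a b c := by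
  simp only [longestSide, dist_comm b a, max_comm (dist b c)]

/-- Projections in a common window of length D - 3/4 leave distances of at most D - 3/4 + 1/4. The
window will start at m = 0 or m = 3/4. -/
theorem longestSide_le_of_projection {s : Set Plane} {ξ : Plane → ℝ} {D m : ℝ}
    (hdist : ∀ x ∈ s, ∀ y ∈ s, dist x y ≤ |ξ x - ξ y| + 1 / 4) {a b c : Plane}
    (ha : a ∈ s) (hb : b ∈ s) (hc : c ∈ s) (ha' : m ≤ ξ a ∧ ξ a ≤ m + (D - 3 / 4))
    (hb' : m ≤ ξ b ∧ ξ b ≤ m + (D - 3 / 4)) (hc' : m ≤ ξ c ∧ ξ c ≤ m + (D - 3 / 4)) :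
    longestSide a b c ≤ D - 1 / 2 := by
  have key : ∀ {x y}, x ∈ s → y ∈ s → (m ≤ ξ x ∧ ξ x ≤ m + (D - 3 / 4)) →
      (m ≤ ξ y ∧ ξ y ≤ m + (D - 3 / 4)) → dist x y ≤ D - 1 / 2 := by
    intro x y hx hy h1 h2
    have : |ξ x - ξ y| ≤ D - 3 / 4 := by rw [abs_le]; constructor <;> linarith
    linarith [hdist x hx y hy]
  exact max_le (key ha hb ha' hb') (max_le (key ha hc ha' hc') (key hb hc hb' hc'))

theorem dist_le_of_mem_closedTriangle {a b c q x : Plane} {R : ℝ} (ha : dist a q ≤ R)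
    (hb : dist b q ≤ R) (hc : dist c q ≤ R) (hx : x ∈ closedTriangle a b c) : dist x q ≤ R := by
  obtain ⟨α, β, γ, h1, h2, h3, hs, rfl⟩ := hx
  rw [dist_eq_norm] at *
  have e : α • a + β • b + γ • c - q = α • (a - q) + β • (b - q) + γ • (c - q) := by
    obtain rfl : α = 1 - β - γ := by linarith
    module
  calc ‖α • a + β • b + γ • c - q‖
      ≤ ‖α • (a - q)‖ + ‖β • (b - q)‖ + ‖γ • (c - q)‖ := e ▸ norm_add₃_le
    _ ≤ α * R + β * R + γ * R := by
        rw [norm_smul, norm_smul, norm_smul, Real.norm_of_nonneg h1, Real.norm_of_nonneg h2,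
          Real.norm_of_nonneg h3]
        gcongr
    _ = R := by rw [← add_mul, ← add_mul, hs, one_mul]

theorem dist_le_longestSide {a b c x y : Plane} (hx : x ∈ closedTriangle a b c)
    (hy : y ∈ closedTriangle a b c) : dist x y ≤ longestSide a b c := by
  have hab : dist a b ≤ longestSide a b c := le_max_left _ _
  have hac : dist a c ≤ longestSide a b c := (le_max_left _ _).trans (le_max_right _ _)
  have hbc : dist b c ≤ longestSide a b c := (le_max_right _ _).trans (le_max_right _ _)
  have h0 : 0 ≤ longestSide a b c := dist_nonneg.trans hab
  refine dist_le_of_mem_closedTriangle ?_ ?_ ?_ hx <;> rw [dist_comm] <;>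
    refine dist_le_of_mem_closedTriangle ?_ ?_ ?_ hy <;> simpa [dist_comm]

theorem longestSide_le {a b c x y z : Plane} (hx : x ∈ closedTriangle a b c)
    (hy : y ∈ closedTriangle a b c) (hz : z ∈ closedTriangle a b c) :
    longestSide x y z ≤ longestSide a b c :=
  max_le (dist_le_longestSide hx hy) (max_le (dist_le_longestSide hx hz)
    (dist_le_longestSide hy hz))

/-! ### Descent on the longest side -/

namespace IsPlanarStraightLineDrawing

variable {V : Type} {G : SimpleGraph V} {p : V → Plane}

/-- A chain whose outer triangle is longest at a side other than the base is followed by a chain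
whose outer triangle is shorter. -/
theorem exists_shorter_chain (hp : IsPlanarStraightLineDrawing G p)
    (hlen : ∀ u v, G.Adj u v → 1 ≤ dist (p u) (p v)) {n : ℕ} {u v x y z : V}
    (h : Chain G p (n + 1) u v x y z) (ho : |orient (p u) (p v) (p x)| ≤ 1 / 4)
    (hD : longestSide (p u) (p v) (p x) = dist (p u) (p x)) :
    ∃ u' v' x' y' z', Chain G p n u' v' x' y' z' ∧
      |orient (p u') (p v') (p x')| ≤ |orient (p u) (p v) (p x)| ∧
      longestSide (p u') (p v') (p x') ≤ longestSide (p u) (p v) (p x) - 1 / 2 := by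
  have hT : closedTriangle (p u) (p x) (p v) = closedTriangle (p u) (p v) (p x) := by
    ext q; constructor <;>
    · rintro ⟨α, β, γ, h1, h2, h3, hs, rfl⟩
      exact ⟨α, γ, β, h1, h3, h2, by linarith, by module⟩
  obtain ⟨ξ, hξu, hξx, hrange, hdist, haff⟩ := exists_projection (hlen u x h.outer.2.1)
    (c := p v) (hD ▸ le_max_left _ _)
    (by rw [dist_comm]; exact hD ▸ (le_max_right _ _).trans (le_max_right _ _))
    (by rwa [orient_swap_right, abs_neg])
  rw [hT] at hrange hdist
  rw [hD]
  set D := dist (p u) (p x)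
  have hum := left_mem_closedTriangle (p u) (p v) (p x)
  have hvm := mid_mem_closedTriangle (p u) (p v) (p x)
  have hxm := right_mem_closedTriangle (p u) (p v) (p x)
  have hy := h.mem_outer
  have hym := openTriangle_subset_closedTriangle _ _ _ hy
  have hz : p z ∈ openTriangle (p u) (p v) (p x) := by
    have : openTriangle (p u) (p v) (p y) ⊆ openTriangle (p u) (p v) (p x) := by
      rw [← openTriangle_rotate (p u) (p v) (p y)]
      exact openTriangle_subset_openTriangle hvm hy hum
    exact this h.mem_middle
  have hzm := openTriangle_subset_closedTriangle _ _ _ hz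
  have hgap : ∀ {s t : V}, G.Adj s t → p s ∈ closedTriangle (p u) (p v) (p x) →
      p t ∈ closedTriangle (p u) (p v) (p x) → 3 / 4 ≤ |ξ (p s) - ξ (p t)| := by
    intro s t hst hs ht
    linarith [hdist _ hs _ ht, hlen s t hst]
  have hpos : ∀ {t : V}, G.Adj u t → p t ∈ closedTriangle (p u) (p v) (p x) →
      3 / 4 ≤ ξ (p t) := by
    intro t hut ht
    have := hgap hut hum ht
    rwa [hξu, zero_sub, abs_neg, abs_of_nonneg (hrange _ ht).1] at this
  have hv1 : 3 / 4 ≤ ξ (p v) := hpos h.outer.1 hvm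
  have hv2 : ξ (p v) ≤ D - 3 / 4 := by
    have := hgap h.outer.2.2 hvm hxm
    rw [hξx, abs_sub_comm, abs_of_nonneg (by linarith [(hrange _ hvm).2])] at this
    linarith
  -- If w projects short of v, any chain on vw will do: the window is [0, D - 3/4] when its apex
  -- also projects short of v, and [3/4, D] otherwise.
  have left : ∀ w, IsTri G u v w → p w ∈ openTriangle (p u) (p v) (p x) → Deep G (n + 1) v w u →
      ξ (p w) < ξ (p v) → ∃ u' v' x' y' z', Chain G p n u' v' x' y' z' ∧
      |orient (p u') (p v') (p x')| ≤ |orient (p u) (p v) (p x)| ∧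
      longestSide (p u') (p v') (p x') ≤ D - 1 / 2 := by
    intro w htri hw hdeep hlt
    have hwm := openTriangle_subset_closedTriangle _ _ _ hw
    obtain ⟨x', y', z', hc, -⟩ := hp.exists_chain hdeep
    have hx'm := hp.neighbor_mem_closedTriangle h.outer hc.outer.2.2 hw
    refine ⟨v, w, x', y', z', hc, abs_orient_le_of_subset
      (openTriangle_subset_openTriangle hvm hw hx'm), ?_⟩
    have hw1 := hpos htri.2.1 hwm
    have hr := hrange _ hx'm
    rcases le_total (ξ (p x')) (ξ (p v)) with hle | hle
    · exact longestSide_le_of_projection (m := 0) hdist hvm hwm hx'm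
        ⟨by linarith, by linarith⟩ ⟨by linarith, by linarith⟩ ⟨by linarith, by linarith⟩
    · exact longestSide_le_of_projection (m := 3 / 4) hdist hvm hwm hx'm
        ⟨by linarith, by linarith⟩ ⟨by linarith, by linarith⟩ ⟨by linarith, by linarith⟩
  rcases lt_or_ge (ξ (p y)) (ξ (p v)) with hyv | hyv
  · exact left y h.middle hy h.deep_middle.2 hyv
  rcases lt_or_ge (ξ (p z)) (ξ (p v)) with hzv | hzv
  · exact left z h.inner hz h.deep_inner.2 hzv
  -- Now y and z project beyond v. The edge uz bars the apex x' over vy from returning towards u: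
  -- unless x' = z, its u-coordinate in uvz is negative. So x' projects beyond v too.
  obtain ⟨x', y', z', hc, hx'u⟩ := hp.exists_chain h.deep_middle.2
  have hx'm := hp.neighbor_mem_closedTriangle h.outer hc.outer.2.2 hy
  refine ⟨v, y, x', y', z', hc, abs_orient_le_of_subset
    (openTriangle_subset_openTriangle hvm hy hx'm), ?_⟩
  have hx'v : ξ (p v) ≤ ξ (p x') := by
    by_cases hxz : x' = z
    · rw [hxz]; exact hzv
    obtain ⟨α, β, γ, hs, hcomb⟩ := exists_barycentric (hp.orient_ne_zero h.inner) (p x')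
    obtain ⟨hα, hγ⟩ := hp.opposite_coord_neg h.outer h.middle h.inner h.mem_outer h.mem_middle
      hc.outer hx'u hxz hs hcomb
    rw [hcomb, haff _ _ _ _ _ _ hs, hξu]
    have : γ * ξ (p v) ≤ γ * ξ (p z) := mul_le_mul_of_nonneg_left hzv hγ.le
    obtain rfl : β = 1 - α - γ := by linarith
    nlinarith
  have h1 := (hrange _ hym).2
  have h2 := (hrange _ hx'm).2
  exact longestSide_le_of_projection (m := 3 / 4) hdist hvm hym hx'm
    ⟨by linarith, by linarith⟩ ⟨by linarith, by linarith⟩ ⟨by linarith, by linarith⟩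

/-- A chain whose outer triangle is longest at its base is followed by a chain with a shorter
base. -/
theorem exists_chain_shorter_base (hp : IsPlanarStraightLineDrawing G p)
    (hlen : ∀ u v, G.Adj u v → 1 ≤ dist (p u) (p v)) {n : ℕ} {u v x y z : V}
    (h : Chain G p (n + 1) u v x y z) (ho : |orient (p u) (p v) (p x)| ≤ 1 / 4)
    (hD : longestSide (p u) (p v) (p x) = dist (p u) (p v)) :
    ∃ u' v' x' y' z', Chain G p n u' v' x' y' z' ∧
      |orient (p u') (p v') (p x')| ≤ |orient (p u) (p v) (p x)| ∧
      dist (p u') (p v') ≤ longestSide (p u) (p v) (p x) - 1 / 2 ∧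
      longestSide (p u') (p v') (p x') ≤ longestSide (p u) (p v) (p x) := by
  obtain ⟨ξ, hξu, hξv, hrange, hdist, -⟩ := exists_projection (hlen u v h.outer.1)
    (c := p x) (hD ▸ (le_max_left _ _).trans (le_max_right _ _))
    (hD ▸ (le_max_right _ _).trans (le_max_right _ _)) ho
  have hum := left_mem_closedTriangle (p u) (p v) (p x)
  have hvm := mid_mem_closedTriangle (p u) (p v) (p x)
  have hym := openTriangle_subset_closedTriangle _ _ _ h.mem_outer
  obtain ⟨x', y', z', hc, -⟩ := hp.exists_chain h.deep_middle.1
  have hx'm := hp.neighbor_mem_closedTriangle h.outer hc.outer.2.2 h.mem_outer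
  refine ⟨u, y, x', y', z', hc, abs_orient_le_of_subset
    (openTriangle_subset_openTriangle hum h.mem_outer hx'm), ?_, longestSide_le hum hym hx'm⟩
  rw [hD]
  have h1 := hdist _ hvm _ hym
  have h2 := hdist _ hum _ hym
  obtain ⟨h3, h4⟩ := hrange _ hym
  have h5 := hlen v y h.middle.2.2
  rw [hξv, abs_of_nonneg (by linarith)] at h1
  rw [hξu, zero_sub, abs_neg, abs_of_nonneg h3] at h2
  linarith

/-- The longest side of a flat chain bounds the number of stages that can follow it. -/
theorem stages_le (hp : IsPlanarStraightLineDrawing G p)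
    (hlen : ∀ u v, G.Adj u v → 1 ≤ dist (p u) (p v)) (n : ℕ) :
    ∀ u v x y z : V, Chain G p n u v x y z → |orient (p u) (p v) (p x)| ≤ 1 / 4 →
      ((n : ℝ) + 3) / 2 ≤ 2 * longestSide (p u) (p v) (p x) ∧
      (dist (p u) (p v) < longestSide (p u) (p v) (p x) →
        ((n : ℝ) + 3) / 2 ≤ 2 * longestSide (p u) (p v) (p x) - 1 / 2) := by
  -- Each stage costs 1/2. A step from a triangle not longest at its base lowers twice the longest
  -- side by 1, leaving 1/2 to spare. A step from the other kind either gains as much or leads to a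
  -- triangle not longest at its base, whose spare 1/2 pays.
  induction n with
  | zero =>
    intro u v x y z h _
    have : 1 ≤ longestSide (p u) (p v) (p x) := (hlen u v h.outer.1).trans (le_max_left _ _)
    push_cast
    constructor
    · linarith
    · intro; linarith
  | succ n ih =>
    intro u v x y z h ho
    push_cast
    have notBase : ∀ {u v}, Chain G p (n + 1) u v x y z → |orient (p u) (p v) (p x)| ≤ 1 / 4 →
        longestSide (p u) (p v) (p x) = dist (p u) (p x) →
        ((n : ℝ) + 1 + 3) / 2 ≤ 2 * longestSide (p u) (p v) (p x) - 1 / 2 := by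
      intro u v h ho hD
      obtain ⟨u', v', x', y', z', h', ho', hle⟩ := hp.exists_shorter_chain hlen h ho hD
      linarith [(ih _ _ _ _ _ h' (ho'.trans ho)).1]
    have hmax : longestSide (p u) (p v) (p x) = dist (p u) (p v) ∨
        ((n : ℝ) + 1 + 3) / 2 ≤ 2 * longestSide (p u) (p v) (p x) - 1 / 2 := by
      rcases max_choice (dist (p u) (p v)) (max (dist (p u) (p x)) (dist (p v) (p x))) with h1 | h1
      · exact .inl h1
      right
      rcases max_choice (dist (p u) (p x)) (dist (p v) (p x)) with h2 | h2
      · exact notBase h ho (h1.trans h2)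
      · rw [← longestSide_swap]
        refine notBase h.swap (by rwa [orient_swap, abs_neg]) ?_
        rw [longestSide_swap]; exact h1.trans h2
    rcases hmax with hD | hD
    · refine ⟨?_, fun hlt => absurd hD hlt.ne'⟩
      obtain ⟨u', v', x', y', z', h', ho', hb, hle⟩ := hp.exists_chain_shorter_base hlen h ho hD
      obtain ⟨h1, h2⟩ := ih _ _ _ _ _ h' (ho'.trans ho)
      have hbase : dist (p u') (p v') ≤ longestSide (p u') (p v') (p x') := le_max_left _ _
      rcases hbase.eq_or_lt with heq | hlt
      · linarith
      · linarith [h2 hlt]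
    · exact ⟨by linarith, fun _ => hD⟩

theorem exists_chain_small (hp : IsPlanarStraightLineDrawing G p) (n k : ℕ) {u v x y z : V}
    (h : Chain G p (n + k) u v x y z) : ∃ u' v' x' y' z', Chain G p n u' v' x' y' z' ∧
      2 ^ k * |orient (p u') (p v') (p x')| ≤ |orient (p u) (p v) (p x)| := by
  induction k generalizing u v x y z with
  | zero => exact ⟨u, v, x, y, z, h, by simp⟩
  | succ k ih =>
    obtain ⟨u1, v1, x1, y1, z1, h1, hle⟩ := hp.exists_chain_half h
    obtain ⟨u2, v2, x2, y2, z2, h2, hle'⟩ := ih h1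
    exact ⟨u2, v2, x2, y2, z2, h2, by rw [pow_succ]; linarith⟩

/-- A drawing with edge lengths in `[1, r)` does not admit an edge with too many stages on it. -/
theorem not_deep_of_short_edges (hp : IsPlanarStraightLineDrawing G p) {r : ℝ} (hr : 1 ≤ r)
    (hlen : ∀ u v, G.Adj u v → 1 ≤ dist (p u) (p v))
    (hlen' : ∀ u v, G.Adj u v → dist (p u) (p v) < r) {u v a : V} :
    ¬ Deep G (⌈2 + 2 * Real.logb 2 r⌉₊ + ⌈4 * r⌉₊) u v a := by
  intro h
  -- One stage forms the first chain and k stages reduce its doubled area from r^2 to 1/4. For the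
  -- remaining m, with L the longest side, m + 3 ≤ 4 L < 4 r ≤ m + 1 is absurd.
  obtain ⟨m, hm⟩ : ∃ m, ⌈4 * r⌉₊ = m + 1 :=
    Nat.exists_eq_succ_of_ne_zero (Nat.ceil_pos.2 (by linarith)).ne'
  have hm' : 4 * r ≤ (m : ℝ) + 1 := by
    have := Nat.le_ceil (4 * r); rw [hm] at this; exact_mod_cast this
  set k := ⌈2 + 2 * Real.logb 2 r⌉₊
  rw [hm, ← add_assoc, add_comm k] at h
  obtain ⟨x, y, z, hc, -⟩ := hp.exists_chain h
  obtain ⟨u', v', x', y', z', hc', hle⟩ := hp.exists_chain_small m k hc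
  have h1 : |orient (p u) (p v) (p x)| ≤ r ^ 2 := by
    refine (abs_orient_le_mul_dist _ _ _).trans ?_
    rw [sq]
    have := hlen' _ _ hc.outer.1
    have := hlen' _ _ hc.outer.2.1
    gcongr
  have hk : 4 * r ^ 2 ≤ 2 ^ k := by
    have h2 : (2 : ℝ) + 2 * Real.logb 2 r ≤ k := Nat.le_ceil _
    have h3 : (2 : ℝ) ^ (2 + 2 * Real.logb 2 r) ≤ 2 ^ (k : ℝ) :=
      Real.rpow_le_rpow_of_exponent_le (by norm_num) h2
    rw [Real.rpow_natCast, Real.rpow_add (by norm_num), mul_comm 2 (Real.logb 2 r),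
      Real.rpow_mul (by norm_num), Real.rpow_logb (by norm_num) (by norm_num) (by linarith)] at h3
    norm_num at h3
    exact h3
  have h4 : |orient (p u') (p v') (p x')| ≤ 1 / 4 := by
    by_contra! hcon
    have : 4 * r ^ 2 * (1 / 4) < 2 ^ k * |orient (p u') (p v') (p x')| :=
      mul_lt_mul' hk hcon (by norm_num) (by positivity)
    linarith
  have h5 := (hp.stages_le hlen m _ _ _ _ _ hc' h4).1
  have h6 : longestSide (p u') (p v') (p x') < r :=
    max_lt (hlen' _ _ hc'.outer.1) (max_lt (hlen' _ _ hc'.outer.2.1) (hlen' _ _ hc'.outer.2.2))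
  linarith

end IsPlanarStraightLineDrawing

/-! ### The stages are 2-trees with deep edges -/

theorem IsTwoTree.of_iso {V : Type} {G : SimpleGraph V} (h : IsTwoTree G) {W : Type}
    {H : SimpleGraph W} (e : G ≃g H) : IsTwoTree H := by
  induction h generalizing W with
  | edge G u v huv hV =>
    refine .edge H (e u) (e v) (e.map_adj_iff.2 huv) fun x => ?_
    rcases hV (e.symm x) with h | h
    · left; rw [← h, e.apply_symm_apply]
    · right; rw [← h, e.apply_symm_apply]
  | addSimplicial G w u v huv hw _ ih =>
    refine .addSimplicial H (e w) (e u) (e v) (e.map_adj_iff.2 huv) (fun x => ?_) (ih ?_)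
    · obtain ⟨x, rfl⟩ := e.surjective x
      rw [e.map_adj_iff, hw]
      simp
    · exact ⟨e.toEquiv.subtypeEquiv (fun x => by simp), e.map_adj_iff⟩

theorem IsTwoTree.finite {V : Type} {G : SimpleGraph V} (h : IsTwoTree G) : Finite V := by
  induction h with
  | edge G u v huv hV =>
    refine Set.finite_univ_iff.1 ((Set.toFinite {u, v}).subset fun x _ => ?_)
    simpa using hV x
  | @addSimplicial V G w u v huv hw _ ih =>
    refine Set.finite_univ_iff.1 (((Set.toFinite {x : V | x ≠ w}).insert w).subset fun x _ => ?_)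
    by_cases h : x = w <;> simp [h]

theorem IsTwoTree.addFive {V : Type} {G : SimpleGraph V} (h : IsTwoTree G) {F : Set (Sym2 V)}
    (hF : F ⊆ G.edgeSet) : IsTwoTree (addFive G F) := by
  classical
  have := h.finite
  -- The new vertices are added one at a time. They are pairwise nonadjacent, so each has only the
  -- ends of its edge as neighbours.
  have key : ∀ S : Finset (F × Fin 5),
      IsTwoTree ((_root_.addFive G F).induce {x | ∀ a, x = .inr a → a ∈ S}) := by
    intro S
    induction S using Finset.induction_on with
    | empty =>
      refine h.of_iso ⟨⟨fun x => ⟨.inl x, by simp⟩, fun x => match x with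
        | ⟨.inl x, _⟩ => x
        | ⟨.inr a, ha⟩ => absurd (ha a rfl) (Finset.notMem_empty a), fun x => rfl, ?_⟩, Iff.rfl⟩
      rintro ⟨x | a, ha⟩
      · rfl
      · exact absurd (ha a rfl) (Finset.notMem_empty a)
    | insert a S haS ih =>
      obtain ⟨⟨e, he⟩, j⟩ := a
      induction e with
      | _ u v =>
      refine .addSimplicial _ ⟨.inr (⟨s(u, v), he⟩, j), fun a ha =>
        Finset.mem_insert.2 (.inl (Sum.inr_injective ha).symm)⟩ ⟨.inl u, by simp⟩
        ⟨.inl v, by simp⟩ (hF he) ?_ (ih.of_iso ⟨⟨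
          fun x => ⟨⟨x.1, fun a ha => Finset.mem_insert_of_mem (x.2 a ha)⟩, ?_⟩,
          fun x => ⟨x.1.1, fun a ha => (Finset.mem_insert.1 (x.1.2 a ha)).resolve_left ?_⟩,
          fun x => rfl, fun x => rfl⟩, Iff.rfl⟩)
      · rintro ⟨x | a, hx⟩
        · simp only [SimpleGraph.comap_adj, Function.Embedding.subtype_apply, Subtype.mk.injEq,
            Sum.inl.injEq]
          exact Sym2.mem_iff
        · simp only [SimpleGraph.comap_adj, Function.Embedding.subtype_apply, Subtype.mk.injEq,
            reduceCtorEq, or_self, iff_false]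
          exact id
      · intro hx
        exact haS (x.2 _ (congrArg Subtype.val hx))
      · rintro rfl
        exact x.2 (Subtype.ext ha)
  have := Fintype.ofFinite (F × Fin 5)
  exact (key Finset.univ).of_iso ⟨Equiv.subtypeUnivEquiv (by simp), Iff.rfl⟩

theorem newEdges_subset_edgeSet (i : ℕ) :
    (labeledStage i).newEdges ⊆ (labeledStage i).graph.edgeSet := by
  cases i with
  | zero => exact subset_rfl
  | succ i =>
    rintro e ⟨u, a, hu, rfl⟩
    exact hu

theorem isTwoTree_labeledStage (i : ℕ) : IsTwoTree (labeledStage i).graph := by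
  induction i with
  | zero =>
    change IsTwoTree (⊤ : SimpleGraph (Fin 3))
    refine .addSimplicial _ 2 0 1 (by simp) (by decide)
      (.edge _ ⟨0, by simp⟩ ⟨1, by simp⟩ (by simp) ?_)
    rintro ⟨x, hx⟩
    simp only [Subtype.mk.injEq]
    change x ≠ 2 at hx
    lia
  | succ i ih => exact ih.addFive (newEdges_subset_edgeSet i)

/-- Induction on the number n of stages still to come. The corner a to be avoided is arbitrary,
since new vertices differ from all old ones. -/
theorem exists_embedding_deep (n : ℕ) : ∀ i N : ℕ, i + n = N →
    ∃ f : (labeledStage i).V → (labeledStage N).V, Function.Injective f ∧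
      (∀ u v, (labeledStage i).graph.Adj u v → (labeledStage N).graph.Adj (f u) (f v)) ∧
      ∀ u v a, s(u, v) ∈ (labeledStage i).newEdges →
        Deep (labeledStage N).graph n (f u) (f v) (f a) := by
  induction n with
  | zero =>
    rintro i N rfl
    exact ⟨id, Function.injective_id, fun _ _ h => h,
      fun u v _ h => newEdges_subset_edgeSet i h⟩
  | succ n ih =>
    rintro i N rfl
    obtain ⟨f, hf, hadj, hdeep⟩ := ih (i + 1) (i + (n + 1)) (by lia)
    refine ⟨fun x => f (.inl x), hf.comp Sum.inl_injective, fun u v h => hadj _ _ h,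
      fun u v a h => ⟨hadj _ _ (newEdges_subset_edgeSet i h),
        fun j => f (.inr (⟨s(u, v), h⟩, j)), fun j k hjk => ?_, fun j => ⟨?_, ?_, ?_⟩⟩⟩
    · exact (Prod.ext_iff.1 (Sum.inr_injective (hf hjk))).2
    · exact hf.ne Sum.inr_ne_inl
    · exact hdeep _ _ _ ⟨u, (⟨s(u, v), h⟩, j), Sym2.mem_mk_left _ _, rfl⟩
    · exact hdeep _ _ _ ⟨v, (⟨s(u, v), h⟩, j), Sym2.mem_mk_right _ _, rfl⟩

theorem exists_deep (N : ℕ) : ∃ u v a, Deep (labeledStage N).graph N u v a := by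
  obtain ⟨f, -, -, h⟩ := exists_embedding_deep N 0 N (by simp)
  exact ⟨_, _, _, h (0 : Fin 3) (1 : Fin 3) (2 : Fin 3)
    (show s(0, 1) ∈ (⊤ : SimpleGraph (Fin 3)).edgeSet by simp)⟩

/-! ### Every 2-tree has a planar straight-line drawing -/

open Filter Topology

/-- The point at height `ε` in direction `n` over the midpoint of `a` and `b`. -/
noncomputable def tentTop (a b n : Plane) (ε : ℝ) : Plane :=
  (1 / 2 : ℝ) • a + (1 / 2 : ℝ) • b + ε • n

theorem tentTop_swap (a b n : Plane) (ε : ℝ) : tentTop b a n ε = tentTop a b n ε := by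
  simp only [tentTop]; module

theorem eventually_mul_abs_lt (c : ℝ) {y : ℝ} (hy : 0 < y) : ∀ᶠ ε in 𝓝[>] (0 : ℝ), ε * |c| < y := by
  have : Tendsto (fun ε : ℝ => ε * |c|) (𝓝 0) (𝓝 (0 * |c|)) :=
    (continuous_id.mul continuous_const).tendsto 0
  rw [zero_mul] at this
  exact nhdsWithin_le_nhds (this.eventually_lt_const hy)

theorem orient_tentTop (a b n : Plane) (ε : ℝ) :
    orient a b (tentTop a b n ε) = ε * orient a b (a + n) := by
  simp only [orient, tentTop, PiLp.add_apply, PiLp.smul_apply, smul_eq_mul]; ring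

theorem orient_lineMap (a b c d : Plane) (t : ℝ) :
    orient a b (AffineMap.lineMap c d t) = (1 - t) * orient a b c + t * orient a b d := by
  simp only [orient, AffineMap.lineMap_apply_module, PiLp.add_apply, PiLp.smul_apply, smul_eq_mul]
  ring

theorem orient_eq_zero_of_mem_segment {a b x : Plane} (h : x ∈ segment ℝ a b) :
    orient a b x = 0 := by
  obtain ⟨s, t, -, -, hst, rfl⟩ := h
  obtain rfl : s = 1 - t := by linarith
  simp only [orient, PiLp.add_apply, PiLp.smul_apply, smul_eq_mul]; ring

/-- A low tent over `ab` does not meet a segment that avoids `ab`. -/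
theorem eventually_notMem_of_disjoint (a b n x y : Plane)
    (h : Disjoint (segment ℝ a b) (segment ℝ x y)) :
    ∀ᶠ ε in 𝓝[>] (0 : ℝ), ∀ t : ℝ, 0 < t → t ≤ 1 →
      AffineMap.lineMap a (tentTop a b n ε) t ∉ segment ℝ x y := by
  have hc : ∀ c d : Plane, IsCompact (segment ℝ c d) := fun c d => by
    rw [segment_eq_image_lineMap]
    exact isCompact_Icc.image AffineMap.lineMap_continuous
  -- Disjoint compact segments have disjoint δ-neighbourhoods, and the tent stays within ε‖n‖ of ab.
  obtain ⟨δ, hδ, hd⟩ := h.exists_thickenings (hc a b) (hc x y).isClosed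
  filter_upwards [eventually_mul_abs_lt ‖n‖ hδ, self_mem_nhdsWithin] with ε hε hε0 t ht0 ht1 hmem
  refine Set.disjoint_left.1 hd ?_ (Metric.self_subset_thickening hδ _ hmem)
  rw [Metric.mem_thickening_iff]
  refine ⟨AffineMap.lineMap a b (t / 2), ?_, ?_⟩
  · rw [segment_eq_image_lineMap]
    exact ⟨t / 2, ⟨by linarith, by linarith⟩, rfl⟩
  · have e : AffineMap.lineMap a (tentTop a b n ε) t - AffineMap.lineMap a b (t / 2) =
        (t * ε) • n := by
      simp only [AffineMap.lineMap_apply_module, tentTop]; module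
    have h0 : 0 < ε := hε0
    rw [dist_eq_norm, e, norm_smul, Real.norm_of_nonneg (by positivity)]
    rw [abs_of_nonneg (norm_nonneg n)] at hε
    have : t * (ε * ‖n‖) ≤ 1 * (ε * ‖n‖) := by gcongr
    linarith

/-- A low tent over `ab` does not meet a segment starting at `a` or at `b`. -/
theorem eventually_notMem_of_end (a b n c y : Plane) (hn : orient a b (a + n) ≠ 0)
    (hc : c = a ∨ c = b) :
    ∀ᶠ ε in 𝓝[>] (0 : ℝ), ∀ t : ℝ, 0 < t → t ≤ 1 →
      AffineMap.lineMap a (tentTop a b n ε) t ∉ segment ℝ c y := by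
  have hY : ∀ ε t : ℝ, AffineMap.lineMap a (tentTop a b n ε) t ∈ segment ℝ c y →
      orient a b y = 0 → 0 < ε → 0 < t → False := by
    intro ε t hmem hy hε ht
    have h1 : orient a b (AffineMap.lineMap a (tentTop a b n ε) t) = 0 := by
      rw [segment_eq_image_lineMap] at hmem
      obtain ⟨τ, -, h⟩ := hmem
      have h0 : orient a b c = 0 := by
        rcases hc with rfl | rfl <;> simp only [orient] <;> ring
      rw [← h, orient_lineMap, hy, h0]; simp
    rw [orient_lineMap, orient_tentTop] at h1
    have h0 : orient a b a = 0 := by simp only [orient]; ring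
    rw [h0, mul_zero, zero_add] at h1
    have := mul_ne_zero ht.ne' (mul_ne_zero hε.ne' hn)
    exact this h1
  -- If y is on the line ab, the tent does not return to that line. Otherwise, for small ε, `orient
  -- c y` keeps on the tent side, for t > 0, the sign it has at the end of ab other than c.
  by_cases hy : orient a b y = 0
  · filter_upwards [self_mem_nhdsWithin] with ε hε t ht _ hmem
    exact hY ε t hmem hy hε ht
  have hpos : 0 < |orient a b y| / 2 := by positivity
  filter_upwards [eventually_mul_abs_lt ((y 0 - c 0) * n 1 - (y 1 - c 1) * n 0) hpos,
    self_mem_nhdsWithin] with ε hε hε0 t ht0 ht1 hmem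
  have h0 : 0 < ε := hε0
  have h1 := orient_eq_zero_of_mem_segment hmem
  set k := (y 0 - c 0) * n 1 - (y 1 - c 1) * n 0
  have h2 : orient c y (tentTop a b n ε) = 1 / 2 * orient c y a + 1 / 2 * orient c y b + ε * k := by
    simp only [orient, tentTop, PiLp.add_apply, PiLp.smul_apply, smul_eq_mul, k]; ring
  have h4 := abs_lt.1 (show |ε * k| < |orient a b y| / 2 by rwa [abs_mul, abs_of_pos h0])
  rw [orient_lineMap, h2] at h1
  have h5 : (1 - t) * |orient a b y| ≥ 0 := mul_nonneg (by linarith) (abs_nonneg _)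
  have h6 : t * (ε * k) < t * (|orient a b y| / 2) := mul_lt_mul_of_pos_left h4.2 ht0
  have h7 : t * -(|orient a b y| / 2) < t * (ε * k) := mul_lt_mul_of_pos_left h4.1 ht0
  rcases hc with rfl | rfl
  · have e1 : orient c y c = 0 := by simp only [orient]; ring
    have e2 : orient c y b = -orient c b y := orient_swap_right _ _ _
    rw [e1, e2] at h1
    rcases abs_choice (orient c b y) with h | h <;> rw [h] at h6 h7 <;> nlinarith
  · have e1 : orient c y c = 0 := by simp only [orient]; ring
    have e2 : orient c y a = orient a c y := by simp only [orient]; ring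
    rw [e1, e2] at h1
    rcases abs_choice (orient a c y) with h | h <;> rw [h] at h5 h6 h7 <;> nlinarith

theorem exists_orient_add_ne_zero {a b : Plane} (h : a ≠ b) : ∃ n, orient a b (a + n) ≠ 0 := by
  by_cases h0 : b 0 = a 0
  · refine ⟨!₂[1, 0], ?_⟩
    simp only [orient, PiLp.add_apply]
    simp [h0]
    exact fun h1 => h (plane_ext h0.symm (by linarith))
  · refine ⟨!₂[0, 1], ?_⟩
    simp only [orient, PiLp.add_apply]
    simp
    exact fun h1 => h0 (by linarith)

namespace IsPlanarStraightLineDrawing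

variable {V : Type} {G : SimpleGraph V} {p : V → Plane}

/-- Allowing x = y treats vertices as degenerate segments, so that a new vertex can avoid vertices
and edges by one argument. -/
theorem disjoint_segment (hp : IsPlanarStraightLineDrawing G p) {u v x y : V} (huv : G.Adj u v)
    (hxy : x = y ∨ G.Adj x y) (hxu : x ≠ u) (hxv : x ≠ v) (hyu : y ≠ u) (hyv : y ≠ v) :
    Disjoint (segment ℝ (p u) (p v)) (segment ℝ (p x) (p y)) := by
  rw [Set.disjoint_left]
  intro z hz hz'
  rcases hxy with rfl | hxy
  · rw [segment_same, Set.mem_singleton_iff] at hz'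
    exact hp.vertex_notMem u v x huv hxu hxv (hz' ▸ hz)
  by_cases h1 : p x = z
  · exact hp.vertex_notMem u v x huv hxu hxv (h1 ▸ hz)
  by_cases h2 : p y = z
  · exact hp.vertex_notMem u v y huv hyu hyv (h2 ▸ hz)
  have := hp.eq_of_openSegment_meets_segment hxy huv (mem_openSegment_of_ne_left_right h1 h2 hz') hz
  rw [Sym2.eq_iff] at this
  tauto

/-- Over every edge of a drawing there is room for a new vertex. -/
theorem exists_apex [Finite V] (hp : IsPlanarStraightLineDrawing G p) {u v : V} (huv : G.Adj u v) :
    ∃ q : Plane, orient (p u) (p v) q ≠ 0 ∧ ∀ x y, (x = y ∨ G.Adj x y) →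
      ∀ t : ℝ, 0 < t → t ≤ 1 → AffineMap.lineMap (p u) q t ∉ segment ℝ (p x) (p y) ∧
        AffineMap.lineMap (p v) q t ∉ segment ℝ (p x) (p y) := by
  obtain ⟨n, hn⟩ := exists_orient_add_ne_zero (hp.injective.ne huv.ne)
  have hn' : orient (p v) (p u) (p v + n) ≠ 0 := by
    have : orient (p v) (p u) (p v + n) = -orient (p u) (p v) (p u + n) := by
      simp only [orient, PiLp.add_apply]; ring
    rw [this]; exact neg_ne_zero.2 hn
  have key : ∀ a b, G.Adj a b → orient (p a) (p b) (p a + n) ≠ 0 → ∀ x y, (x = y ∨ G.Adj x y) →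
      ∀ᶠ ε in 𝓝[>] (0 : ℝ), ∀ t : ℝ, 0 < t → t ≤ 1 →
        AffineMap.lineMap (p a) (tentTop (p a) (p b) n ε) t ∉ segment ℝ (p x) (p y) := by
    intro a b hab hn x y hxy
    by_cases hx : x = a ∨ x = b
    · exact eventually_notMem_of_end _ _ _ _ _ hn (hx.imp (congrArg p) (congrArg p))
    by_cases hy : y = a ∨ y = b
    · rw [segment_symm]
      exact eventually_notMem_of_end _ _ _ _ _ hn (hy.imp (congrArg p) (congrArg p))
    push Not at hx hy
    exact eventually_notMem_of_disjoint _ _ _ _ _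
      (hp.disjoint_segment hab hxy hx.1 hx.2 hy.1 hy.2)
  have hall : ∀ᶠ ε in 𝓝[>] (0 : ℝ), ∀ x y, (x = y ∨ G.Adj x y) → ∀ t : ℝ, 0 < t → t ≤ 1 →
      AffineMap.lineMap (p u) (tentTop (p u) (p v) n ε) t ∉ segment ℝ (p x) (p y) ∧
      AffineMap.lineMap (p v) (tentTop (p u) (p v) n ε) t ∉ segment ℝ (p x) (p y) := by
    rw [eventually_all]; intro x
    rw [eventually_all]; intro y
    by_cases hxy : x = y ∨ G.Adj x y
    · filter_upwards [key u v huv hn x y hxy, key v u huv.symm hn' x y hxy] with ε h1 h2 _ t ht ht'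
      exact ⟨h1 t ht ht', tentTop_swap (p u) (p v) n ε ▸ h2 t ht ht'⟩
    · exact Eventually.of_forall fun ε h => absurd h hxy
  obtain ⟨ε, hε, hε0⟩ := (hall.and self_mem_nhdsWithin).exists
  refine ⟨tentTop (p u) (p v) n ε, ?_, hε⟩
  rw [orient_tentTop]
  exact mul_ne_zero (ne_of_gt hε0) hn

end IsPlanarStraightLineDrawing

/-- A drawing extends to a vertex attached to an edge. -/
theorem exists_drawing_of_addSimplicial {V : Type} [Finite V] {G : SimpleGraph V} {w u v : V}
    (huv : G.Adj u v) (hw : ∀ x : V, G.Adj w x ↔ x = u ∨ x = v) {p : {x : V | x ≠ w} → Plane}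
    (hp : IsPlanarStraightLineDrawing (G.induce {x : V | x ≠ w}) p) :
    ∃ P : V → Plane, IsPlanarStraightLineDrawing G P := by
  classical
  have hwu : G.Adj w u := (hw u).2 (.inl rfl)
  have hwv : G.Adj w v := (hw v).2 (.inr rfl)
  obtain ⟨q, hq, hA⟩ := hp.exists_apex (u := ⟨u, hwu.ne'⟩) (v := ⟨v, hwv.ne'⟩) huv
  let P : V → Plane := fun x => if h : x = w then q else p ⟨x, h⟩
  have hPw : P w = q := dif_pos rfl
  have hP : ∀ x (h : x ≠ w), P x = p ⟨x, h⟩ := fun x h => dif_neg h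
  have avoid : ∀ a, G.Adj w a → ∀ x y, x ≠ w → y ≠ w → (x = y ∨ G.Adj x y) →
      ∀ t : ℝ, 0 < t → t ≤ 1 → AffineMap.lineMap (P a) q t ∉ segment ℝ (P x) (P y) := by
    intro a ha x y hx hy hxy t ht0 ht1
    have := hA ⟨x, hx⟩ ⟨y, hy⟩ (hxy.imp (fun h => Subtype.ext h) id) t ht0 ht1
    rw [hP x hx, hP y hy, hP a ha.ne']
    rcases (hw a).1 ha with rfl | rfl
    · exact this.1
    · exact this.2
  have apex_ne : ∀ a, G.Adj w a → ∀ x y, x ≠ w → y ≠ w → (x = y ∨ G.Adj x y) →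
      q ∉ segment ℝ (P x) (P y) := by
    intro a ha x y hx hy hxy
    have := avoid a ha x y hx hy hxy 1 one_pos le_rfl
    rwa [AffineMap.lineMap_apply_one] at this
  have newEdge : ∀ a c, G.Adj w a → c ≠ w → c ≠ a → P c ∉ segment ℝ (P a) q := by
    intro a c ha hc hca hmem
    rw [segment_eq_image_lineMap] at hmem
    obtain ⟨t, ⟨ht0, ht1⟩, ht⟩ := hmem
    rcases ht0.eq_or_lt with rfl | ht0
    · rw [AffineMap.lineMap_apply_zero, hP a ha.ne', hP c hc] at ht
      exact hca (congrArg Subtype.val (hp.injective ht)).symm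
    · exact avoid a ha c c hc hc (.inl rfl) t ht0 ht1 (ht ▸ left_mem_segment ℝ _ _)
  -- The line through q and u meets the segment from v to q only at q, because q is off the line uv.
  have two_new : Disjoint (openSegment ℝ (P u) q) (openSegment ℝ (P v) q) := by
    rw [Set.disjoint_left]
    rw [hP u hwu.ne', hP v hwv.ne']
    intro z hz hz'
    have h1 : orient q (p ⟨u, hwu.ne'⟩) z = 0 :=
      orient_eq_zero_of_mem_segment (openSegment_subset_segment ℝ _ _ (openSegment_symm ℝ q _ ▸ hz))
    rw [openSegment_eq_image_lineMap] at hz'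
    obtain ⟨t, ⟨ht0, ht1⟩, rfl⟩ := hz'
    have h0 : orient q (p ⟨u, hwu.ne'⟩) q = 0 := by simp only [orient]; ring
    rw [orient_lineMap, h0, mul_zero, add_zero, ← orient_rotate] at h1
    exact mul_ne_zero (by linarith) hq h1
  have two_new' : ∀ a b, G.Adj w a → G.Adj w b → a ≠ b →
      Disjoint (openSegment ℝ (P a) q) (openSegment ℝ (P b) q) := by
    intro a b ha hb hab
    rcases (hw a).1 ha with rfl | rfl <;> rcases (hw b).1 hb with rfl | rfl
    · exact absurd rfl hab
    · exact two_new
    · exact two_new.symm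
    · exact absurd rfl hab
  have disj : ∀ a, G.Adj w a → ∀ x y, G.Adj x y → s(w, a) ≠ s(x, y) →
      Disjoint (openSegment ℝ (P a) q) (openSegment ℝ (P x) (P y)) := by
    intro a ha x y hxy hne
    by_cases hx : x = w
    · subst hx
      rw [hPw, openSegment_symm ℝ q]
      exact two_new' a y ha hxy fun h => hne (by rw [h])
    by_cases hy : y = w
    · subst hy
      rw [hPw]
      exact two_new' a x ha hxy.symm fun h => hne (by rw [h, Sym2.eq_swap])
    rw [Set.disjoint_left]
    intro z hz hz'
    rw [openSegment_eq_image_lineMap] at hz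
    obtain ⟨t, ⟨ht0, ht1⟩, rfl⟩ := hz
    exact avoid a ha x y hx hy (.inr hxy) t ht0 ht1.le (openSegment_subset_segment ℝ _ _ hz')
  refine ⟨P, ?_, ?_, ?_⟩
  · intro x y hxy
    by_cases hx : x = w <;> by_cases hy : y = w
    · rw [hx, hy]
    · rw [hx, hPw] at hxy
      exact absurd (hxy ▸ left_mem_segment ℝ _ _) (apex_ne u hwu y y hy hy (.inl rfl))
    · rw [hy, hPw] at hxy
      exact absurd (hxy ▸ left_mem_segment ℝ _ _) (apex_ne u hwu x x hx hx (.inl rfl))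
    · rw [hP x hx, hP y hy] at hxy
      exact congrArg Subtype.val (hp.injective hxy)
  · intro s t c hst hcs hct
    by_cases hs : s = w
    · subst hs
      rw [hPw, segment_symm]
      exact newEdge t c hst hcs hct
    by_cases ht : t = w
    · subst ht
      rw [hPw]
      exact newEdge s c hst.symm hct hcs
    by_cases hc : c = w
    · rw [hc, hPw]
      exact apex_ne u hwu s t hs ht (.inr hst)
    · rw [hP s hs, hP t ht, hP c hc]
      exact hp.vertex_notMem ⟨s, hs⟩ ⟨t, ht⟩ ⟨c, hc⟩ hst (fun h => hcs (congrArg Subtype.val h))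
        (fun h => hct (congrArg Subtype.val h))
  · intro s t x y hst hxy hne
    by_cases hs : s = w
    · subst hs
      rw [hPw, openSegment_symm ℝ q]
      exact disj t hst x y hxy hne
    by_cases ht : t = w
    · subst ht
      rw [hPw]
      exact disj s hst.symm x y hxy (Sym2.eq_swap ▸ hne)
    by_cases hx : x = w
    · subst hx
      rw [hPw, openSegment_symm ℝ q]
      exact (disj y hxy s t hst hne.symm).symm
    by_cases hy : y = w
    · subst hy
      rw [hPw]
      exact (disj x hxy.symm s t hst (Sym2.eq_swap ▸ hne.symm)).symm
    rw [hP s hs, hP t ht, hP x hx, hP y hy]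
    refine hp.edges_disjoint ⟨s, hs⟩ ⟨t, ht⟩ ⟨x, hx⟩ ⟨y, hy⟩ hst hxy fun h => hne ?_
    exact congrArg (Sym2.map Subtype.val) h

theorem IsTwoTree.exists_drawing {V : Type} {G : SimpleGraph V} (h : IsTwoTree G) :
    ∃ p : V → Plane, IsPlanarStraightLineDrawing G p := by
  classical
  induction h with
  | edge G u v huv hV =>
    have hne : ∀ {a b}, G.Adj a b → s(a, b) = s(u, v) := by
      intro a b hab
      have := hab.ne
      rcases hV a with rfl | rfl <;> rcases hV b with rfl | rfl <;> simp_all [Sym2.eq_swap]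
    refine ⟨fun x => if x = u then 0 else !₂[1, 0], ?_, ?_, ?_⟩
    · have h01 : (0 : Plane) ≠ !₂[1, 0] := fun h => by
        have := congrArg (fun x : Plane => x 0) h
        simp at this
      intro x y hxy
      have := huv.ne'
      rcases hV x with rfl | rfl <;> rcases hV y with rfl | rfl <;> simp_all [h01.symm]
    · intro a b c hab hca hcb
      have := hab.ne
      rcases hV a with rfl | rfl <;> rcases hV b with rfl | rfl <;> rcases hV c with rfl | rfl <;>
        simp_all
    · intro a b x y hab hxy h
      exact absurd ((hne hab).trans (hne hxy).symm) h
  | @addSimplicial V G w u v huv hw hG ih =>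
    obtain ⟨p, hp⟩ := ih
    have := (IsTwoTree.addSimplicial G w u v huv hw hG).finite
    exact exists_drawing_of_addSimplicial huv hw hp

/-! ### Scaling and conclusion -/

namespace IsPlanarStraightLineDrawing

variable {V : Type} {G : SimpleGraph V} {p : V → Plane}

theorem smul (hp : IsPlanarStraightLineDrawing G p) {s : ℝ} (hs : s ≠ 0) :
    IsPlanarStraightLineDrawing G fun x => s • p x := by
  have hinj : Function.Injective fun x : Plane => s • x := smul_right_injective _ hs
  have hseg : ∀ a b : Plane, segment ℝ (s • a) (s • b) = (fun x => s • x) '' segment ℝ a b :=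
    fun a b => (image_segment ℝ (LinearMap.lsmul ℝ Plane s).toAffineMap a b).symm
  have hopen : ∀ a b : Plane,
      openSegment ℝ (s • a) (s • b) = (fun x => s • x) '' openSegment ℝ a b :=
    fun a b => (image_openSegment ℝ (LinearMap.lsmul ℝ Plane s).toAffineMap a b).symm
  refine ⟨hinj.comp hp.injective, fun u v w h h1 h2 => ?_, fun u v x y h1 h2 h => ?_⟩
  · rw [hseg]
    rintro ⟨z, hz, hzw⟩
    exact hp.vertex_notMem u v w h h1 h2 (hinj hzw ▸ hz)
  · rw [hopen, hopen, Set.disjoint_image_iff hinj]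
    exact hp.edges_disjoint u v x y h1 h2 h

/-- Every drawing of a graph with an edge on which sufficiently many stages are built has
edge-length ratio at least `r`. -/
theorem le_drawingRatio [Finite V] (hp : IsPlanarStraightLineDrawing G p) {r : ℝ} (hr : 1 ≤ r)
    {u v a : V} (h : Deep G (⌈2 + 2 * Real.logb 2 r⌉₊ + ⌈4 * r⌉₊) u v a) :
    r ≤ drawingRatio G p := by
  by_contra! hlt
  have hfin : (edgeLengths G p).Finite := by
    refine (Set.finite_range fun e : V × V => dist (p e.1) (p e.2)).subset ?_
    rintro d ⟨x, y, -, rfl⟩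
    exact ⟨(x, y), rfl⟩
  have hne : (edgeLengths G p).Nonempty := ⟨_, u, v, h.adj, rfl⟩
  have hmin : ∀ x y, G.Adj x y → sInf (edgeLengths G p) ≤ dist (p x) (p y) :=
    fun x y hxy => csInf_le hfin.bddBelow ⟨x, y, hxy, rfl⟩
  have hmax : ∀ x y, G.Adj x y → dist (p x) (p y) ≤ sSup (edgeLengths G p) :=
    fun x y hxy => le_csSup hfin.bddAbove ⟨x, y, hxy, rfl⟩
  have hpos : 0 < sInf (edgeLengths G p) := by
    obtain ⟨x, y, hxy, hd⟩ := hne.csInf_mem hfin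
    rw [hd]
    exact dist_pos.2 (hp.injective.ne hxy.ne)
  -- Dividing by the shortest length turns a ratio below r into edge lengths in [1, r).
  set m := sInf (edgeLengths G p)
  rw [drawingRatio, div_lt_iff₀ hpos] at hlt
  have hdist : ∀ x y, dist (m⁻¹ • p x) (m⁻¹ • p y) = dist (p x) (p y) / m := by
    intro x y
    rw [dist_smul₀, Real.norm_of_nonneg (by positivity), inv_mul_eq_div]
  refine (hp.smul (inv_ne_zero hpos.ne')).not_deep_of_short_edges hr (fun x y hxy => ?_)
    (fun x y hxy => ?_) h
  · rw [hdist, le_div_iff₀ hpos, one_mul]; exact hmin x y hxy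
  · rw [hdist, div_lt_iff₀ hpos]; exact (hmax x y hxy).trans_lt hlt

end IsPlanarStraightLineDrawing

theorem theorem1 (r : ℝ) (hr : 1 ≤ r) :
    ∃ (V : Type) (G : SimpleGraph V), Finite V ∧ IsTwoTree G ∧
      Nonempty (G ≃g (labeledStage (⌈2 + 2 * Real.logb 2 r⌉₊ + ⌈4 * r⌉₊)).graph) ∧
      r ≤ edgeLengthRatio G := by
  have htree := isTwoTree_labeledStage (⌈2 + 2 * Real.logb 2 r⌉₊ + ⌈4 * r⌉₊)
  refine ⟨_, _, htree.finite, htree, ⟨.refl⟩, ?_⟩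
  have := htree.finite
  obtain ⟨u, v, a, h⟩ := exists_deep (⌈2 + 2 * Real.logb 2 r⌉₊ + ⌈4 * r⌉₊)
  obtain ⟨p, hp⟩ := htree.exists_drawing
  refine le_csInf ⟨_, p, hp, rfl⟩ ?_
  rintro _ ⟨p', hp', rfl⟩
  exact hp'.le_drawingRatio hr h
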